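/- **Theorem (Cauchy's Theorem).** Let $\mathrm{Cl}_{0,n}$ be the real Clifford algebra with generators $e_1,\dots,e_n$, $e_ie_j+e_je_i=-2\delta_{ij}$, and write $y=(y_0,y_1,\dots,y_n)\in\mathbb R^{n+1}$. Fix a sign $s\in\{1,-1\}$, put $\varepsilon_0=1$, $\varepsilon_j=s\,e_j$ for $1\le j\le n$, and let $$Df=\sum_{j=0}^n\varepsilon_j\frac{\partial f}{\partial y_j}=\frac{\partial f}{\partial y_0}+s\sum_{j=1}^n e_j\frac{\partial f}{\partial y_j},\qquad d\sigma=\sum_{j=0}^n(-1)^j\varepsilon_j\,dy_0\wedge\dots\wedge[dy_j]\wedge\dots\wedge dy_n .$$ Let $W\subseteq\mathbb R^{n+1}$ be open and let $\Omega\subseteq W$ be a bounded domain with Lipschitz boundary, $\partial\Omega$ being oriented by the outward normal (the case $W=\Omega$ is allowed). Let $C_b(\overline W)$ be the space of bounded continuous functions $\overline W\to\mathrm{Cl}_{0,n}$ with the supremum norm, and let $M$ be a bounded real-linear operator on $C_b(\overline W)$ that commutes with $D$, that is: if $f,h\in C_b(\overline W)$ and $Df=h$ in the sense of distributions on $W$,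 then $D(Mf)=Mh$ in the sense of distributions on $W$. Let $\mathcal M_M(W)$ be the set of all $f\in C_b(\overline W)$ that are differentiable in $W$ and satisfy $Df=Mf$ there, and put $(e^{-y_0M}f)(y)=\sum_{k\ge0}\frac{(-y_0)^k}{k!}(M^kf)(y)$. Then for every $f\in\mathcal M_M(W)$ the following integral exists and $$\int_{\partial\Omega}d\sigma_y\,(e^{-y_0M}f)(y)=0 .$$ In particular, let $\lambda\in\mathrm{Cl}_{0,n}$ and let $M_\lambda f=f\lambda$ be multiplication by $\lambda$ from the right. If $f\in\mathcal M_{M_\lambda}(W)$, that is, if $Df=f\lambda$ in $W$, then $$\int_{\partial\Omega}d\sigma_y\,f(y)\,e^{-y_0\lambda}=0,$$ and if moreover $\lambda\in\mathbb R$, then also $$\int_{\partial\Omega}d\sigma_y\,e^{-y_0\lambda}f(y)=0 .$$ -/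

import Mathlib

open MeasureTheory Topology
open scoped ContDiff BoundedContinuousFunction

noncomputable section

namespace CliffordCauchy

/-- The quadratic form `-(x₁² + ⋯ + xₙ²)` on `ℝⁿ`. -/
abbrev negForm (n : ℕ) : QuadraticForm ℝ (Fin n → ℝ) :=
  QuadraticMap.weightedSumSquares ℝ (fun _ : Fin n => (-1 : ℝ))

/-- The real Clifford algebra with `n` generators of square `-1`. -/
abbrev Cl (n : ℕ) : Type := CliffordAlgebra (negForm n)

/-- The generators `e₁, …, eₙ` (indexed from `0`). -/
def gen {n : ℕ} (j : Fin n) : Cl n := CliffordAlgebra.ι (negForm n) (Pi.single j 1)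

/-- The anti-commutation relations `eᵢ eⱼ + eⱼ eᵢ = -2 δᵢⱼ`. -/
theorem gen_anticomm {n : ℕ} (i j : Fin n) :
    gen i * gen j + gen j * gen i = if i = j then (-2 : Cl n) else 0 := by
  unfold gen
  rw [CliffordAlgebra.ι_mul_ι_add_swap]
  have h : QuadraticMap.polar (negForm n) (Pi.single i 1) (Pi.single j 1)
      = if i = j then (-2 : ℝ) else 0 := by
    simp only [QuadraticMap.polar, QuadraticMap.weightedSumSquares_apply, ← Finset.sum_sub_distrib]
    rw [Finset.sum_eq_single i]
    · by_cases hij : i = j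
      · subst hij
        simp
        norm_num
      · simp [hij]
    · intro b _ hb
      simp [Pi.single_apply, hb]
    · simp
  rw [h]
  split_ifs
  · rw [map_neg, map_ofNat]
  · exact map_zero _

instance finite_Cl (n : ℕ) : Module.Finite ℝ (Cl n) := by
  have : Invertible (2 : ℝ) := invertibleOfNonzero two_ne_zero
  have : Module.Finite ℝ (ExteriorAlgebra ℝ (Fin n → ℝ)) :=
    Module.Finite.of_basis (Pi.basisFun ℝ (Fin n)).ExteriorAlgebra
  exact Module.Finite.equiv (CliffordAlgebra.equivExterior (negForm n)).symm

/-- Left multiplication, as a faithful representation by real matrices. -/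
def leftMat (n : ℕ) :
    Cl n →ₐ[ℝ] Matrix (Fin (Module.finrank ℝ (Cl n))) (Fin (Module.finrank ℝ (Cl n))) ℝ :=
  Algebra.leftMulMatrix (Module.finBasis ℝ (Cl n))

/-- A submultiplicative norm on the finite-dimensional algebra `Cl n`. All norms on a
finite-dimensional real vector space are equivalent; the norm serves only to speak of limits,
derivatives, integrals and bounded operators, for which the choice is immaterial. -/
instance normedRing_Cl (n : ℕ) : NormedRing (Cl n) :=
  letI := Matrix.linftyOpNormedRing (n := Fin (Module.finrank ℝ (Cl n))) (α := ℝ)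
  NormedRing.induced (Cl n) _ (leftMat n)
    (Algebra.leftMulMatrix_injective (Module.finBasis ℝ (Cl n)))

instance normedAlgebra_Cl (n : ℕ) : NormedAlgebra ℝ (Cl n) :=
  letI := Matrix.linftyOpNormedRing (n := Fin (Module.finrank ℝ (Cl n))) (α := ℝ)
  letI := Matrix.linftyOpNormedAlgebra (R := ℝ) (n := Fin (Module.finrank ℝ (Cl n))) (α := ℝ)
  NormedAlgebra.induced ℝ (Cl n) _ (leftMat n)

instance completeSpace_Cl (n : ℕ) : CompleteSpace (Cl n) := FiniteDimensional.complete ℝ (Cl n)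

/-- `ℝⁿ⁺¹` with coordinates `y₀, y₁, …, yₙ`. -/
abbrev E (n : ℕ) : Type := EuclideanSpace ℝ (Fin (n + 1))

/-- `e₀ = 1` and `s e₁, …, s eₙ`, where `s` is a sign. -/
def unit {n : ℕ} (s : ℤˣ) : Fin (n + 1) → Cl n :=
  Fin.cons 1 (fun j => ((s : ℤ) : ℝ) • gen j)

/-- The partial derivative `∂f/∂yⱼ`. -/
def partialDeriv {n : ℕ} {F : Type*} [NormedAddCommGroup F] [NormedSpace ℝ F]
    (j : Fin (n + 1)) (f : E n → F) (y : E n) : F :=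
  fderiv ℝ f y (EuclideanSpace.single j 1)

/-- The generalized Cauchy-Riemann operator `D f = ∂f/∂y₀ + s ∑ⱼ eⱼ ∂f/∂yⱼ`. -/
def cauchyRiemann {n : ℕ} (s : ℤˣ) (f : E n → Cl n) (y : E n) : Cl n :=
  ∑ j, unit s j * partialDeriv j f y

/-- `D f = h` on `W` in the sense of distributions, tested against real `φ ∈ C_c^∞(W)`. -/
def WeakCauchyRiemann {n : ℕ} (s : ℤˣ) (W : Set (E n)) (f h : E n → Cl n) : Prop :=
  ∀ φ : E n → ℝ, ContDiff ℝ ∞ φ → HasCompactSupport φ → tsupport φ ⊆ W →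
    ∫ y, ∑ j, partialDeriv j φ y • (unit s j * f y) = -∫ y, φ y • h y

/-- Bounded continuous functions on the closure of `W`, with the supremum norm. -/
abbrev Fun (n : ℕ) (W : Set (E n)) : Type := closure W →ᵇ Cl n

open Classical in
/-- The values of `f ∈ C_b(closure W)` as a function on `ℝⁿ⁺¹` (zero off `closure W`). -/
def ext {n : ℕ} {W : Set (E n)} (f : Fun n W) (y : E n) : Cl n :=
  if h : y ∈ closure W then f ⟨y, h⟩ else 0

/-- The bounded operator `M` commutes with `D`: it maps the maximal (distributional) domain of
`D` in `C_b(closure W)` to itself and `D M = M D` there. -/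
def CommutesWithD {n : ℕ} (s : ℤˣ) (W : Set (E n)) (M : Fun n W →L[ℝ] Fun n W) : Prop :=
  ∀ f h : Fun n W, WeakCauchyRiemann s W (ext f) (ext h) →
    WeakCauchyRiemann s W (ext (M f)) (ext (M h))

/-- The `M`-solutions: functions in `C_b(closure W)` that are differentiable in `W` and satisfy
`D f = M f` there. -/
def massSolutions {n : ℕ} (s : ℤˣ) (W : Set (E n)) (M : Fun n W →L[ℝ] Fun n W) :
    Set (Fun n W) :=
  {f | DifferentiableOn ℝ (ext f) W ∧ ∀ y ∈ W, cauchyRiemann s (ext f) y = ext (M f) y}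

/-- The operator `M_λ` of multiplication by the Clifford number `λ` from the right. -/
def rightMul {n : ℕ} (W : Set (E n)) (lam : Cl n) : Fun n W →L[ℝ] Fun n W :=
  ((ContinuousLinearMap.mul ℝ (Cl n)).flip lam).compLeftContinuousBounded (closure W)

theorem rightMul_apply {n : ℕ} (W : Set (E n)) (lam : Cl n) (f : Fun n W) (y : closure W) :
    rightMul W lam f y = f y * lam := rfl

/-- `(e^{-y₀ M} f)(y) = ∑ₖ (-y₀)ᵏ / k! (Mᵏ f)(y)`, an absolutely convergent series as `M` is
bounded. -/
def expNeg {n : ℕ} {W : Set (E n)} (M : Fun n W →L[ℝ] Fun n W) (f : Fun n W) (y : E n) : Cl n :=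
  ∑' k : ℕ, ((-(y 0)) ^ k / (k.factorial : ℝ)) • ext ((M ^ k) f) y

/-- The point of `ℝⁿ⁺¹` with coordinates `(t, u₁, …, uₙ)`. -/
def consPt {n : ℕ} (t : ℝ) (u : EuclideanSpace ℝ (Fin n)) : E n :=
  WithLp.toLp 2 (Fin.cons t (fun i => u i))

/-- The coordinates `(z₁, …, zₙ)`. -/
def tailPt {n : ℕ} (z : E n) : EuclideanSpace ℝ (Fin n) :=
  WithLp.toLp 2 (fun i : Fin n => z i.succ)

/-- A boundary chart of `Ω`: an open set `U` in which, in the Cartesian coordinates `A⁻¹ y`, the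
set `Ω` is the region `{z₀ < φ(z₁, …, zₙ)}` below the graph of a Lipschitz function `φ`. -/
structure BoundaryChart {n : ℕ} (Ω : Set (E n)) where
  U : Set (E n)
  isOpen_U : IsOpen U
  A : E n ≃ₗᵢ[ℝ] E n
  φ : EuclideanSpace ℝ (Fin n) → ℝ
  lipschitz_φ : ∃ K, LipschitzWith K φ
  mem_iff : ∀ y ∈ U, (y ∈ Ω ↔ (A.symm y) 0 < φ (tailPt (A.symm y)))

/-- A bounded domain with Lipschitz boundary. -/
structure IsLipschitzDomain {n : ℕ} (Ω : Set (E n)) : Prop where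
  isOpen : IsOpen Ω
  isConnected : IsConnected Ω
  isBounded : Bornology.IsBounded Ω
  exists_chart : ∀ y ∈ frontier Ω, ∃ c : BoundaryChart Ω, y ∈ c.U

/-- The local parametrization `u ↦ A (φ(u), u)` of the boundary. -/
def BoundaryChart.param {n : ℕ} {Ω : Set (E n)} (c : BoundaryChart Ω)
    (u : EuclideanSpace ℝ (Fin n)) : E n :=
  c.A (consPt (c.φ u) u)

/-- The tangent vectors `∂γ/∂u₁, …, ∂γ/∂uₙ` of the parametrization `γ`. They exist for almost
every `u`, since `γ` is Lipschitz. -/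
def BoundaryChart.tangent {n : ℕ} {Ω : Set (E n)} (c : BoundaryChart Ω)
    (u : EuclideanSpace ℝ (Fin n)) (k : Fin n) : E n :=
  fderiv ℝ c.param u (EuclideanSpace.single k 1)

/-- `+1` if the parametrization is positively oriented for the boundary orientation (outward
vector first), and `-1` otherwise. At the chart the vector `A (1, 0, …, 0)` points outward. -/
def BoundaryChart.orientation {n : ℕ} {Ω : Set (E n)} (c : BoundaryChart Ω) : ℝ :=
  LinearMap.det (c.A.toLinearEquiv : E n →ₗ[ℝ] E n)

/-- The Clifford-algebra-valued `n`-form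
`dσ = ∑ⱼ (-1)ʲ εⱼ dx₀ ∧ ⋯ ∧ [dxⱼ] ∧ ⋯ ∧ dxₙ`, where `ε₀ = 1` and `εⱼ = s eⱼ` for `j ≥ 1`,
evaluated at `n` vectors. -/
def dsigma {n : ℕ} (s : ℤˣ) (v : Fin n → E n) : Cl n :=
  ∑ j : Fin (n + 1),
    ((-1 : ℝ) ^ (j : ℕ) * Matrix.det (Matrix.of fun i k : Fin n => v k (j.succAbove i))) •
      unit s j

/-- Finitely many boundary charts with a smooth partition of unity near the boundary that is
subordinate to them. -/
structure BoundaryAtlas {n : ℕ} (Ω : Set (E n)) where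
  N : ℕ
  chart : Fin N → BoundaryChart Ω
  ψ : Fin N → E n → ℝ
  smooth_ψ : ∀ k, ContDiff ℝ ∞ (ψ k)
  compact_ψ : ∀ k, HasCompactSupport (ψ k)
  tsupport_ψ : ∀ k, tsupport (ψ k) ⊆ (chart k).U
  sum_ψ : ∀ᶠ y in 𝓝ˢ (frontier Ω), ∑ k, ψ k y = 1

/-- The pull-back of `ψₖ dσ g` to the parameter space of the `k`-th chart. -/
def BoundaryAtlas.integrand {n : ℕ} {Ω : Set (E n)} (a : BoundaryAtlas Ω) (s : ℤˣ)
    (g : E n → Cl n) (k : Fin a.N) (u : EuclideanSpace ℝ (Fin n)) : Cl n :=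
  (a.ψ k ((a.chart k).param u) * (a.chart k).orientation) •
    (dsigma s ((a.chart k).tangent u) * g ((a.chart k).param u))

/-- The integral `∫_{∂Ω} dσ g` exists and equals `I`: there are boundary atlases, and for each
of them the local pull-backs are integrable and their integrals add up to `I`. -/
def HasBoundaryIntegral {n : ℕ} (s : ℤˣ) (Ω : Set (E n)) (g : E n → Cl n) (I : Cl n) : Prop :=
  Nonempty (BoundaryAtlas Ω) ∧
    ∀ a : BoundaryAtlas Ω,
      (∀ k, Integrable (a.integrand s g k)) ∧ ∑ k, ∫ u, a.integrand s g k u = I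

end CliffordCauchy

end

noncomputable section

namespace CliffordCauchy

open Filter

variable {n : ℕ} {F : Type*} [NormedAddCommGroup F] [NormedSpace ℝ F]

/-! Put `g = e^{-y₀M} f`. Since `ε₀ = 1`, differentiating the factor `e^{-y₀M}` contributes
`-e^{-y₀M} M f`, which cancels `e^{-y₀M} D f = e^{-y₀M} M f`; hence `D g = 0`. The iterates `Mᵏ f`
need not be differentiable, so this is done weakly: `D (Mᵏ f) = Mᵏ⁺¹ f` is tested against `χ (-y₀)ᵏ
/ k!`, the resulting identities telescope, and the remainder is killed by the factorial
(`weaklyDivFree_expNeg`). The starting point `D f = M f` holds classically and passes to the weak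
form by `WeakCauchyRiemann.of_differentiableOn`.

What remains is Cauchy's theorem for a continuous `g` on `closure Ω` with `D g = 0` weakly in `Ω`,
that is, for the divergence-free field with components `εⱼ g`
(`IsLipschitzDomain.hasBoundaryIntegral_zero`). In a chart, the test function `ψ θ(depth / δ)` is
Lipschitz with compact support in `Ω`. As `δ → 0`, the derivatives falling on `ψ` give an integral
over `Ω`, and those falling on `θ` concentrate on the graph and give a boundary integral against the
gradient of the depth (`BoundaryChart.setIntegral_partialDeriv_smul`). Up to sign this gradient is
the oriented surface form (`BoundaryChart.orientation_smul_dsigma`). For a whole atlas the interior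
integrals cancel, because `1 - ∑ ψₖ`, cut off outside `Ω`, is itself a test function
(`BoundaryAtlas.sum_setIntegral_eq_zero`). -/

/-- The divergence of the vector field `h` vanishes on `Ω` in the sense of distributions. -/
def WeaklyDivFree (Ω : Set (E n)) (h : Fin (n + 1) → E n → F) : Prop :=
  ∀ φ : E n → ℝ, ContDiff ℝ ∞ φ → HasCompactSupport φ → tsupport φ ⊆ Ω →
    ∫ y, ∑ j, partialDeriv j φ y • h j y = 0

/-! ### Lipschitz test functions for weakly divergence-free fields -/

theorem norm_partialDeriv_le_of_lipschitz {f : E n → F} {K : NNReal} (hf : LipschitzWith K f)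
    (j : Fin (n + 1)) (y : E n) : ‖partialDeriv j f y‖ ≤ K := by
  refine ((fderiv ℝ f y).le_opNorm _).trans ?_
  simpa using norm_fderiv_le_of_lipschitz ℝ hf (x₀ := y)

theorem measurable_partialDeriv (f : E n → ℝ) (j : Fin (n + 1)) :
    Measurable (partialDeriv j f) :=
  measurable_fderiv_apply_const ℝ f _

theorem partialDeriv_eq_zero_of_notMem {f : E n → F} {y : E n} (hy : y ∉ tsupport f)
    (j : Fin (n + 1)) : partialDeriv j f y = 0 := by
  have : fderiv ℝ f y = 0 := by
    have h := (notMem_tsupport_iff_eventuallyEq.1 hy)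
    rw [h.fderiv_eq]
    simp
  simp [partialDeriv, this]

theorem continuous_partialDeriv {f : E n → F} (hf : ContDiff ℝ ∞ f) (j : Fin (n + 1)) :
    Continuous (partialDeriv j f) :=
  (hf.continuous_fderiv (by simp)).clm_apply continuous_const

-- The derivative is put on `χ` rather than on the mollifier, so that the Lipschitz constant of `χ`
-- bounds it independently of the mollifier.
open scoped Convolution in
theorem partialDeriv_convolution {ρ χ : E n → ℝ} {K : NNReal} (hρ : Continuous ρ)
    (hρc : HasCompactSupport ρ) (hχ : LipschitzWith K χ) (j : Fin (n + 1)) (x : E n) :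
    partialDeriv j (ρ ⋆[ContinuousLinearMap.lsmul ℝ ℝ, volume] χ) x =
      (ρ ⋆[ContinuousLinearMap.lsmul ℝ ℝ, volume] partialDeriv j χ) x := by
  have hint : Integrable ρ := hρ.integrable_of_hasCompactSupport hρc
  have hc (x : E n) : Continuous fun t => ρ t • χ (x - t) :=
    hρ.smul (hχ.continuous.comp (continuous_const.sub continuous_id))
  have key := hasFDerivAt_integral_of_dominated_loc_of_lip (𝕜 := ℝ) (μ := (volume : Measure (E n)))
    (F := fun x t => ρ t • χ (x - t)) (x₀ := x) (s := Set.univ) (bound := fun t => |ρ t| * K)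
    (F' := fun t => ρ t • fderiv ℝ χ (x - t)) univ_mem
    (Eventually.of_forall fun x => (hc x).aestronglyMeasurable)
    ((hc x).integrable_of_hasCompactSupport hρc.smul_right)
    (hρ.aestronglyMeasurable.smul
      ((measurable_fderiv ℝ χ).comp (measurable_const.sub measurable_id)).aestronglyMeasurable)
    (Eventually.of_forall fun t => by
      refine LipschitzOnWith.of_dist_le_mul fun a _ b _ => ?_
      have := hχ.dist_le_mul (a - t) (b - t)
      rw [dist_sub_right] at this
      rw [dist_smul₀]
      simp only [Real.norm_eq_abs, Real.coe_nnabs, abs_mul, abs_abs, NNReal.abs_eq]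
      calc |ρ t| * dist (χ (a - t)) (χ (b - t)) ≤ |ρ t| * (K * dist a b) := by gcongr
        _ = _ := by ring)
    (hint.abs.mul_const _)
    (by
      -- Rademacher's theorem; the reflection `t ↦ x - t` preserves null sets.
      have hd := hχ.ae_differentiableAt (μ := (volume : Measure (E n)))
      have := (Measure.measurePreserving_sub_left (volume : Measure (E n)) x).quasiMeasurePreserving.ae hd
      filter_upwards [this] with t ht
      have h1 : HasFDerivAt (fun x => χ (x - t)) (fderiv ℝ χ (x - t)) x := by
        have := ht.hasFDerivAt.comp x ((hasFDerivAt_id x).sub_const t)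
        rwa [ContinuousLinearMap.comp_id] at this
      exact h1.const_smul (ρ t))
  have h2 := key.2.fderiv
  unfold partialDeriv
  change fderiv ℝ (fun x => ∫ t, ρ t • χ (x - t)) x _ = ∫ t, ρ t • fderiv ℝ χ (x - t) _
  rw [h2, ContinuousLinearMap.integral_apply key.1]
  rfl

/-- By mollification: the derivatives of the mollified functions stay bounded by `K` and converge at
almost every point, so dominated convergence on a compact neighbourhood of the support applies.
Lipschitz test functions are needed because the depth below a Lipschitz graph is no smoother. -/
theorem WeaklyDivFree.lipschitz {Ω : Set (E n)} {h : Fin (n + 1) → E n → F}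
    (hh : WeaklyDivFree Ω h) (hc : ∀ j, Continuous (h j)) (hΩ : IsOpen Ω) {χ : E n → ℝ}
    {K : NNReal} (hχ : LipschitzWith K χ) (hχc : HasCompactSupport χ) (hsupp : tsupport χ ⊆ Ω) :
    ∫ y, ∑ j, partialDeriv j χ y • h j y = 0 := by
  obtain ⟨δ, hδ, hδΩ⟩ := hχc.isCompact.exists_cthickening_subset_open hΩ hsupp
  set L := Metric.cthickening δ (tsupport χ) with hL
  have hLc : IsCompact L := hχc.isCompact.cthickening
  -- The outer radius is at most `δ`, which keeps supports in the thickening `L ⊆ Ω`; the fixed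
  -- ratio `2` of the radii is what the Lebesgue differentiation argument for `hae` requires.
  let ρ : ℕ → ContDiffBump (0 : E n) := fun i =>
    { rIn := δ / (i + 1) / 2, rOut := δ / (i + 1), rIn_pos := by positivity,
      rIn_lt_rOut := half_lt_self (by positivity) }
  let ρn : ℕ → E n → ℝ := fun i => (ρ i).normed volume
  let χn : ℕ → E n → ℝ := fun i =>
    MeasureTheory.convolution (ρn i) χ (ContinuousLinearMap.lsmul ℝ ℝ) volume
  have hρlim : Tendsto (fun i => (ρ i).rOut) atTop (𝓝 0) := by
    have := tendsto_one_div_add_atTop_nhds_zero_nat (𝕜 := ℝ)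
    simpa [ρ, div_eq_mul_inv] using this.const_mul δ
  have hρc (i) : Continuous (ρn i) := ((ρ i).contDiff_normed (n := 0)).continuous
  have hρs (i) : HasCompactSupport (ρn i) := (ρ i).hasCompactSupport_normed
  have hts (i) : tsupport (χn i) ⊆ L := by
    refine closure_minimal ?_ hLc.isClosed
    refine (support_convolution_subset _).trans ?_
    rintro _ ⟨a, ha, b, hb, rfl⟩
    have ha' : a ∈ Metric.ball (0 : E n) (δ / (i + 1)) := by
      have := (ρ i).support_normed_eq (μ := (volume : Measure (E n)))
      exact this ▸ ha
    refine Metric.mem_cthickening_of_dist_le (a + b) b δ _ (subset_tsupport _ hb) ?_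
    have : ‖a‖ < δ / (i + 1) := by simpa using ha'
    have h2 : δ / (i + 1) ≤ δ := div_le_self hδ.le (by linarith [i.cast_nonneg (α := ℝ)])
    simpa using (this.le.trans h2)
  have hcs (i) : HasCompactSupport (χn i) := hLc.of_isClosed_subset (isClosed_tsupport _) (hts i)
  have hsm (i) : ContDiff ℝ ∞ (χn i) :=
    (hρs i).contDiff_convolution_left _ ((ρ i).contDiff_normed) hχ.continuous.locallyIntegrable
  have hpd (i j) (x) : partialDeriv j (χn i) x =
      MeasureTheory.convolution (ρn i) (partialDeriv j χ) (ContinuousLinearMap.lsmul ℝ ℝ) volume x :=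
    partialDeriv_convolution (hρc i) (hρs i) hχ j x
  have hbd (i j) (x) : ‖partialDeriv j (χn i) x‖ ≤ K := by
    rw [hpd]
    refine (norm_integral_le_of_norm_le (g := fun t => ρn i t * K)
      (((hρc i).integrable_of_hasCompactSupport (hρs i)).mul_const _) ?_).trans ?_
    · refine Eventually.of_forall fun t => ?_
      simp only [ContinuousLinearMap.lsmul_apply, norm_smul]
      rw [Real.norm_of_nonneg ((ρ i).nonneg_normed _)]
      have := norm_partialDeriv_le_of_lipschitz hχ j (x - t)
      have h0 : 0 ≤ ρn i t := (ρ i).nonneg_normed _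
      gcongr
    · rw [integral_mul_const, (ρ i).integral_normed, one_mul]
  have hloc (j) : LocallyIntegrable (partialDeriv j χ) volume := by
    refine (locallyIntegrable_const (K : ℝ)).mono (measurable_partialDeriv χ j).aestronglyMeasurable
      (Eventually.of_forall fun x => ?_)
    simpa using norm_partialDeriv_le_of_lipschitz hχ j x
  have hae (j) : ∀ᵐ x : E n, Tendsto (fun i => partialDeriv j (χn i) x) atTop
      (𝓝 (partialDeriv j χ x)) := by
    have := ContDiffBump.ae_convolution_tendsto_right_of_locallyIntegrable (φ := ρ) (l := atTop)
      (K := 2) hρlim (Eventually.of_forall fun i => by simp only [ρ]; linarith) (hloc j)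
    filter_upwards [this] with x hx
    simpa only [hpd] using hx
  have hlim : Tendsto (fun i => ∫ y, ∑ j, partialDeriv j (χn i) y • h j y) atTop
      (𝓝 (∫ y, ∑ j, partialDeriv j χ y • h j y)) := by
    refine tendsto_integral_of_dominated_convergence
      (fun y => L.indicator (fun y => ∑ j, K * ‖h j y‖) y) ?_ ?_ ?_ ?_
    · intro i
      exact (continuous_finsetSum _ fun j _ =>
        (continuous_partialDeriv (hsm i) j).smul (hc j)).aestronglyMeasurable
    · rw [integrable_indicator_iff hLc.measurableSet]
      exact (continuous_finsetSum _ fun j _ =>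
        continuous_const.mul (hc j).norm).continuousOn.integrableOn_compact hLc
    · intro i
      refine Eventually.of_forall fun y => ?_
      by_cases hy : y ∈ L
      · rw [Set.indicator_of_mem hy]
        refine (norm_sum_le _ _).trans (Finset.sum_le_sum fun j _ => ?_)
        rw [norm_smul]
        gcongr
        exact hbd i j y
      · rw [Set.indicator_of_notMem hy, Finset.sum_eq_zero, norm_zero]
        intro j _
        rw [partialDeriv_eq_zero_of_notMem (fun h => hy (hts i h)), zero_smul]
    · filter_upwards [ae_all_iff.2 hae] with y hy
      exact tendsto_finsetSum _ fun j _ => (hy j).smul_const _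
  refine tendsto_nhds_unique hlim ?_
  simp_rw [fun i => hh (χn i) (hsm i) (hcs i) ((hts i).trans hδΩ)]
  exact tendsto_const_nhds

/-! ### Coordinates that flatten the boundary in a chart -/

@[simp] theorem tailPt_consPt (t : ℝ) (u : EuclideanSpace ℝ (Fin n)) :
    tailPt (consPt t u) = u := by
  ext i
  simp [tailPt, consPt]

@[simp] theorem consPt_apply_zero (t : ℝ) (u : EuclideanSpace ℝ (Fin n)) :
    consPt t u 0 = t := by
  simp [consPt]

@[simp] theorem consPt_apply_succ (t : ℝ) (u : EuclideanSpace ℝ (Fin n)) (i : Fin n) :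
    consPt t u i.succ = u i := by
  simp [consPt]

/-- `tailPt` as a continuous linear map. -/
def tailL (n : ℕ) : E n →L[ℝ] EuclideanSpace ℝ (Fin n) :=
  LinearMap.toContinuousLinearMap
    { toFun := tailPt
      map_add' := fun x y => by ext i; simp [tailPt]
      map_smul' := fun r x => by ext i; simp [tailPt] }

@[simp] theorem tailL_apply (z : E n) : tailL n z = tailPt z := rfl

/-- `consPt` as a continuous linear map. -/
def consL (n : ℕ) : ℝ × EuclideanSpace ℝ (Fin n) →L[ℝ] E n :=
  LinearMap.toContinuousLinearMap
    { toFun := fun p => consPt p.1 p.2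
      map_add' := fun p q => by ext i; refine Fin.cases ?_ (fun i => ?_) i <;> simp
      map_smul' := fun r p => by ext i; refine Fin.cases ?_ (fun i => ?_) i <;> simp }

@[simp] theorem consL_apply (p : ℝ × EuclideanSpace ℝ (Fin n)) :
    consL n p = consPt p.1 p.2 := rfl

theorem continuous_consPt :
    Continuous fun p : ℝ × EuclideanSpace ℝ (Fin n) => consPt p.1 p.2 :=
  (consL n).continuous

theorem measurePreserving_consPt :
    MeasurePreserving fun p : ℝ × EuclideanSpace ℝ (Fin n) => consPt p.1 p.2 := by
  have h1 := (volume_preserving_piFinSuccAbove (fun _ : Fin (n + 1) => ℝ) 0).symm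
  have h2 := (MeasurePreserving.id (volume : Measure ℝ)).prod (PiLp.volume_preserving_ofLp (Fin n))
  have h3 := (PiLp.volume_preserving_toLp (Fin (n + 1))).comp (h1.comp h2)
  convert h3 using 1
  · ext p i
    refine Fin.cases ?_ (fun i => ?_) i <;>
      simp [consPt, MeasurableEquiv.piFinSuccAbove]
  · rfl

namespace BoundaryChart

variable {Ω : Set (E n)} (c : BoundaryChart Ω)

/-- The depth of a point below the graph, in the direction of the chart. -/
def depth (y : E n) : ℝ := c.φ (tailPt (c.A.symm y)) - (c.A.symm y) 0

/-- The point at depth `p.1` below the point of the graph over `p.2`. -/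
def flat (p : ℝ × EuclideanSpace ℝ (Fin n)) : E n := c.A (consPt (c.φ p.2 - p.1) p.2)

/-- The components of the gradient of the depth function. -/
def conormal (j : Fin (n + 1)) (u : EuclideanSpace ℝ (Fin n)) : ℝ :=
  fderiv ℝ c.φ u (tailPt (c.A.symm (EuclideanSpace.single j 1))) -
    (c.A.symm (EuclideanSpace.single j 1)) 0

@[simp] theorem depth_flat (p : ℝ × EuclideanSpace ℝ (Fin n)) : c.depth (c.flat p) = p.1 := by
  simp [depth, flat]

@[simp] theorem flat_zero (u : EuclideanSpace ℝ (Fin n)) : c.flat (0, u) = c.param u := by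
  simp [flat, param]

theorem continuous_φ : Continuous c.φ := c.lipschitz_φ.choose_spec.continuous

theorem continuous_flat : Continuous c.flat :=
  c.A.continuous.comp (continuous_consPt.comp
    (((c.continuous_φ.comp continuous_snd).sub continuous_fst).prodMk continuous_snd))

theorem lipschitz_depth : ∃ K, LipschitzWith K c.depth := by
  obtain ⟨K, hK⟩ := c.lipschitz_φ
  have h1 := hK.comp ((tailL n).lipschitz.comp c.A.symm.lipschitz)
  have h2 := (EuclideanSpace.proj 0 : E n →L[ℝ] ℝ).lipschitz.comp
    c.A.symm.lipschitz
  exact ⟨_, h1.sub h2⟩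

theorem continuous_depth : Continuous c.depth := c.lipschitz_depth.choose_spec.continuous

theorem mem_iff_depth {y : E n} (hy : y ∈ c.U) : y ∈ Ω ↔ 0 < c.depth y := by
  rw [c.mem_iff y hy, depth, sub_pos]

/-- For fixed `u` the map `t ↦ φ(u) - t` is a reflection of the line, so flattening is a shear
followed by an isometry; no Jacobian arises, although `φ` is only Lipschitz. -/
theorem measurePreserving_flat : MeasurePreserving c.flat := by
  have hφ := c.continuous_φ
  have h1 := (MeasurePreserving.id (volume : Measure (EuclideanSpace ℝ (Fin n)))).skew_product
    (μc := (volume : Measure ℝ)) (μd := (volume : Measure ℝ)) (g := fun u t => c.φ u - t)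
    (by
      have : Continuous (Function.uncurry fun u t => c.φ u - t) :=
        (hφ.comp continuous_fst).sub continuous_snd
      exact this.measurable)
    (Eventually.of_forall fun u => (Measure.measurePreserving_sub_left volume (c.φ u)).map_eq)
  exact c.A.measurePreserving.comp (measurePreserving_consPt.comp
    (Measure.measurePreserving_swap.comp (h1.comp Measure.measurePreserving_swap)))

theorem integral_comp_flat {g : E n → F} (hg : AEStronglyMeasurable g) :
    ∫ p, g (c.flat p) = ∫ y, g y := by
  rw [← c.measurePreserving_flat.map_eq] at hg ⊢
  rw [integral_map c.continuous_flat.measurable.aemeasurable hg]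

theorem hasFDerivAt_depth {y : E n} (hy : DifferentiableAt ℝ c.φ (tailPt (c.A.symm y))) :
    HasFDerivAt c.depth
      ((fderiv ℝ c.φ (tailPt (c.A.symm y))).comp
        ((tailL n).comp (c.A.symm.toContinuousLinearEquiv : E n →L[ℝ] E n)) -
        (EuclideanSpace.proj 0 : E n →L[ℝ] ℝ).comp
          (c.A.symm.toContinuousLinearEquiv : E n →L[ℝ] E n)) y := by
  have h1 := ((tailL n).comp
    (c.A.symm.toContinuousLinearEquiv : E n →L[ℝ] E n)).hasFDerivAt (x := y)
  have h2 := ((EuclideanSpace.proj 0 : E n →L[ℝ] ℝ).comp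
    (c.A.symm.toContinuousLinearEquiv : E n →L[ℝ] E n)).hasFDerivAt (x := y)
  exact (HasFDerivAt.comp y (g := c.φ) hy.hasFDerivAt h1).sub h2

theorem measurable_conormal (j : Fin (n + 1)) : Measurable (c.conormal j) :=
  (measurable_fderiv_apply_const ℝ c.φ _).sub_const _

theorem conormal_bounded (j : Fin (n + 1)) : ∃ C, ∀ u, ‖c.conormal j u‖ ≤ C := by
  obtain ⟨K, hK⟩ := c.lipschitz_φ
  refine ⟨_, fun u => (norm_sub_le _ _).trans (add_le_add_left (((fderiv ℝ c.φ u).le_opNorm _).trans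
    (mul_le_mul_of_nonneg_right (norm_fderiv_le_of_lipschitz ℝ hK) (norm_nonneg _))) _)⟩

end BoundaryChart

/-! ### The divergence theorem in one boundary chart -/

/-- A smooth cut-off function on the line. -/
theorem exists_smooth_step : ∃ θ θ' : ℝ → ℝ, (∀ t, HasDerivAt θ (θ' t) t) ∧ Continuous θ' ∧
    HasCompactSupport θ' ∧ (∀ t, ‖θ t‖ ≤ 1) ∧ (∀ t ≤ 1, θ t = 0) ∧ (∀ t, 2 ≤ t → θ t = 1) ∧
    (∃ K, LipschitzWith K θ) ∧ ∫ t, θ' t = 1 := by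
  -- The shift by one makes `θ (depth / δ)` vanish where the depth is below `δ`, which keeps the
  -- support of the cut-off at positive depth.
  let θ : ℝ → ℝ := fun t => Real.smoothTransition (t - 1)
  have hsm : ContDiff ℝ 1 θ := Real.smoothTransition.contDiff.comp (contDiff_id.sub contDiff_const)
  have h0 : ∀ t ≤ 1, θ t = 0 := fun t ht => Real.smoothTransition.zero_of_nonpos (by linarith)
  have h1 : ∀ t, 2 ≤ t → θ t = 1 := fun t ht => Real.smoothTransition.one_of_one_le (by linarith)
  have hd : ∀ t, HasDerivAt θ (deriv θ t) t :=
    fun t => (hsm.differentiable (by simp) t).hasDerivAt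
  have hc : Continuous (deriv θ) := hsm.continuous_deriv (by simp)
  have hs : HasCompactSupport (deriv θ) := by
    refine HasCompactSupport.intro (isCompact_Icc (a := (1 : ℝ)) (b := 2)) fun t ht => ?_
    rw [Set.mem_Icc, not_and_or, not_le, not_le] at ht
    rcases ht with ht | ht
    · have : θ =ᶠ[𝓝 t] fun _ => 0 := by
        filter_upwards [Iio_mem_nhds ht] with x hx using h0 x hx.le
      rw [this.deriv_eq, deriv_const]
    · have : θ =ᶠ[𝓝 t] fun _ => 1 := by
        filter_upwards [Ioi_mem_nhds ht] with x hx using h1 x hx.le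
      rw [this.deriv_eq, deriv_const]
  have hb : ∀ t, ‖θ t‖ ≤ 1 := fun t => by
    rw [Real.norm_of_nonneg (Real.smoothTransition.nonneg _)]
    exact Real.smoothTransition.le_one _
  obtain ⟨C, hC⟩ := hs.exists_bound_of_continuous hc
  refine ⟨θ, deriv θ, hd, hc, hs, hb, h0, h1, ⟨C.toNNReal, ?_⟩, ?_⟩
  · refine lipschitzWith_of_nnnorm_deriv_le (hsm.differentiable (by simp)) fun t => ?_
    rw [← NNReal.coe_le_coe, coe_nnnorm]
    exact (hC t).trans (Real.le_coe_toNNReal C)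
  · have := integral_of_hasDerivAt_of_tendsto (m := (0 : ℝ)) (n := (1 : ℝ)) hd
      (hc.integrable_of_hasCompactSupport hs)
      (tendsto_const_nhds.congr' (by
        filter_upwards [eventually_le_atBot (1 : ℝ)] with t ht using (h0 t ht).symm))
      (tendsto_const_nhds.congr' (by
        filter_upwards [eventually_ge_atTop (2 : ℝ)] with t ht using (h1 t ht).symm))
    simpa using this

theorem lipschitzWith_mul_of_bounded {X : Type*} [PseudoMetricSpace X] {f g : X → ℝ}
    {Kf Kg Cf Cg : NNReal} (hf : LipschitzWith Kf f) (hg : LipschitzWith Kg g)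
    (hfb : ∀ x, ‖f x‖ ≤ Cf) (hgb : ∀ x, ‖g x‖ ≤ Cg) :
    LipschitzWith (Cf * Kg + Kf * Cg) fun x => f x * g x := by
  refine LipschitzWith.of_dist_le_mul fun x y => ?_
  have h1 := hf.dist_le_mul x y
  have h2 := hg.dist_le_mul x y
  rw [dist_eq_norm] at h1 h2 ⊢
  calc ‖f x * g x - f y * g y‖ = ‖f x * (g x - g y) + (f x - f y) * g y‖ := by ring_nf
    _ ≤ ‖f x‖ * ‖g x - g y‖ + ‖f x - f y‖ * ‖g y‖ := by
        refine (norm_add_le _ _).trans ?_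
        rw [norm_mul, norm_mul]
    _ ≤ Cf * (Kg * dist x y) + (Kf * dist x y) * Cg := by
        gcongr
        · exact hfb x
        · exact hgb y
    _ = _ := by push_cast; ring

/-- A Lipschitz cut-off of `ψ` away from the boundary is an admissible test function. -/
theorem BoundaryChart.integral_cutoff_eq_zero {Ω : Set (E n)} (c : BoundaryChart Ω)
    (hΩ : IsOpen Ω) {h : Fin (n + 1) → E n → F} (hh : WeaklyDivFree Ω h)
    (hc : ∀ j, Continuous (h j)) {ψ : E n → ℝ} (hψ : ContDiff ℝ ∞ ψ) (hψc : HasCompactSupport ψ)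
    (hψU : tsupport ψ ⊆ c.U) {θ θ' : ℝ → ℝ} (hθ : ∀ t, HasDerivAt θ (θ' t) t)
    (hθb : ∀ t, ‖θ t‖ ≤ 1) (hθ0 : ∀ t ≤ 1, θ t = 0) {K : NNReal} (hθL : LipschitzWith K θ)
    {δ : ℝ} (hδ : 0 < δ) :
    ∫ p : ℝ × EuclideanSpace ℝ (Fin n),
      (θ (δ⁻¹ * p.1) • ∑ j, partialDeriv j ψ (c.flat p) • h j (c.flat p) +
        (θ' (δ⁻¹ * p.1) * δ⁻¹) •
          ∑ j, c.conormal j p.2 • (ψ (c.flat p) • h j (c.flat p))) = 0 := by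
  set χ : E n → ℝ := fun y => ψ y * θ (δ⁻¹ * c.depth y) with hχ
  obtain ⟨Kd, hKd⟩ := c.lipschitz_depth
  obtain ⟨Kψ, hKψ⟩ := hψ.lipschitzWith_of_hasCompactSupport hψc (by simp)
  obtain ⟨C, hC⟩ := hψc.exists_bound_of_continuous hψ.continuous
  have hL : LipschitzWith (K * (‖δ⁻¹‖₊ * Kd)) fun y => θ (δ⁻¹ * c.depth y) :=
    hθL.comp ((lipschitzWith_smul δ⁻¹).comp hKd)
  have hχL := lipschitzWith_mul_of_bounded hKψ hL (Cf := C.toNNReal) (Cg := 1)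
    (fun y => (hC y).trans (Real.le_coe_toNNReal C)) fun y => by simpa using hθb _
  have hχc : HasCompactSupport χ := hψc.mul_right
  have hχΩ : tsupport χ ⊆ Ω := by
    have hsub : tsupport χ ⊆ tsupport ψ ∩ {y | δ ≤ c.depth y} := by
      refine closure_minimal (fun y hy => ?_)
        ((isClosed_tsupport _).inter (isClosed_le continuous_const c.continuous_depth))
      have hy' : ψ y * θ (δ⁻¹ * c.depth y) ≠ 0 := hy
      refine ⟨subset_tsupport _ (left_ne_zero_of_mul hy'), ?_⟩
      by_contra hlt
      refine right_ne_zero_of_mul hy' (hθ0 _ ?_)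
      rw [Set.mem_ofPred_eq, not_le] at hlt
      rw [inv_mul_le_iff₀ hδ, mul_one]
      exact hlt.le
    intro y hy
    obtain ⟨h1, h2⟩ := hsub hy
    exact (c.mem_iff_depth (hψU h1)).2 (hδ.trans_le h2)
  have h0 := hh.lipschitz hc hΩ hχL hχc hχΩ
  have hm : AEStronglyMeasurable fun y => ∑ j, partialDeriv j χ y • h j y :=
    (Finset.stronglyMeasurable_fun_sum _ fun j _ =>
      (measurable_partialDeriv χ j).stronglyMeasurable.smul
        (hc j).stronglyMeasurable).aestronglyMeasurable
  rw [← c.integral_comp_flat hm] at h0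
  rw [← h0]
  obtain ⟨Kφ, hKφ⟩ := c.lipschitz_φ
  -- The exceptional set of Rademacher's theorem does not involve the depth: it is a cylinder over a
  -- null set of parameters.
  have hae : ∀ᵐ p : ℝ × EuclideanSpace ℝ (Fin n), DifferentiableAt ℝ c.φ p.2 :=
    (Measure.quasiMeasurePreserving_snd (μ := (volume : Measure ℝ))).ae
      (hKφ.ae_differentiableAt (μ := volume))
  refine integral_congr_ae ?_
  filter_upwards [hae] with p hp
  have htail : tailPt (c.A.symm (c.flat p)) = p.2 := by simp [BoundaryChart.flat]
  have hdep := c.hasFDerivAt_depth (y := c.flat p) (by rwa [htail])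
  have h1 := (hψ.differentiable (by simp) (c.flat p)).hasFDerivAt.mul
    ((hθ (δ⁻¹ * c.depth (c.flat p))).comp_hasFDerivAt (c.flat p) (hdep.const_mul δ⁻¹))
  have h2 : ∀ j, partialDeriv j χ (c.flat p) = θ (δ⁻¹ * p.1) * partialDeriv j ψ (c.flat p) +
      (θ' (δ⁻¹ * p.1) * δ⁻¹) * (c.conormal j p.2 * ψ (c.flat p)) := by
    intro j
    have := h1.fderiv
    change fderiv ℝ χ (c.flat p) = _ at this
    rw [partialDeriv, this]
    simp [htail, partialDeriv, BoundaryChart.conormal]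
    ring
  simp only [h2, Finset.smul_sum, ← Finset.sum_add_distrib, smul_smul, ← add_smul]

/-- The divergence theorem for weakly divergence free fields, localized to a boundary chart. -/
theorem BoundaryChart.setIntegral_partialDeriv_smul [CompleteSpace F] {Ω : Set (E n)} (c : BoundaryChart Ω)
    (hΩ : IsOpen Ω) {h : Fin (n + 1) → E n → F} (hh : WeaklyDivFree Ω h)
    (hc : ∀ j, Continuous (h j)) {ψ : E n → ℝ} (hψ : ContDiff ℝ ∞ ψ) (hψc : HasCompactSupport ψ)
    (hψU : tsupport ψ ⊆ c.U) :
    ∫ y in Ω, ∑ j, partialDeriv j ψ y • h j y =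
      -∫ u, ∑ j, c.conormal j u • (ψ (c.param u) • h j (c.param u)) := by
  obtain ⟨θ, θ', hθ, hθ'c, hθ's, hθb, hθ0, hθ1, ⟨K, hθL⟩, hθi⟩ := exists_smooth_step
  set b : E n → F := fun y => ∑ j, partialDeriv j ψ y • h j y with hb
  set Q : ℝ × EuclideanSpace ℝ (Fin n) → F :=
    fun p => ∑ j, c.conormal j p.2 • (ψ (c.flat p) • h j (c.flat p)) with hQ
  have hθ'int : Integrable θ' := hθ'c.integrable_of_hasCompactSupport hθ's
  have hbc : Continuous b :=
    continuous_finsetSum _ fun j _ => (continuous_partialDeriv hψ j).smul (hc j)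
  have hb0 : ∀ y, y ∉ tsupport ψ → b y = 0 := fun y hy =>
    Finset.sum_eq_zero fun j _ => by rw [partialDeriv_eq_zero_of_notMem hy, zero_smul]
  have hbs : HasCompactSupport b := HasCompactSupport.intro hψc.isCompact hb0
  have hBint : Integrable fun p => b (c.flat p) :=
    (c.measurePreserving_flat.integrable_comp hbc.aestronglyMeasurable).2
      (hbc.integrable_of_hasCompactSupport hbs)
  -- bounds for `Q`
  set T : Set (EuclideanSpace ℝ (Fin n)) := (fun y => tailPt (c.A.symm y)) '' tsupport ψ with hT
  have hTc : IsCompact T :=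
    hψc.isCompact.image ((tailL n).continuous.comp c.A.symm.continuous)
  have hQm : StronglyMeasurable Q := Finset.stronglyMeasurable_fun_sum _ fun j _ =>
    ((c.measurable_conormal j).comp measurable_snd).stronglyMeasurable.smul
      ((hψ.continuous.comp c.continuous_flat).smul
        ((hc j).comp c.continuous_flat)).stronglyMeasurable
  obtain ⟨C, hC⟩ : ∃ C : ℝ, ∀ p, ‖Q p‖ ≤ C := by
    choose C1 hC1 using c.conormal_bounded
    choose C2 hC2 using fun j => (hψc.smul_right (f' := h j)).exists_bound_of_continuous
      (hψ.continuous.smul (hc j))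
    refine ⟨∑ j, C1 j * C2 j, fun p => (norm_sum_le _ _).trans (Finset.sum_le_sum fun j _ => ?_)⟩
    rw [norm_smul]
    exact mul_le_mul (hC1 j _) (hC2 j _) (norm_nonneg _) ((norm_nonneg _).trans (hC1 j p.2))
  have hQb : ∀ p, ‖Q p‖ ≤ T.indicator (fun _ => C) p.2 := by
    intro p
    by_cases hp : p.2 ∈ T
    · rw [Set.indicator_of_mem hp]
      exact hC p
    · have : ψ (c.flat p) = 0 := by
        by_contra hne
        exact hp ⟨c.flat p, subset_tsupport _ hne, by simp [BoundaryChart.flat]⟩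
      simp [hQ, this, Set.indicator_of_notMem hp]
  have hTint : Integrable (T.indicator fun _ => C) :=
    (integrable_indicator_iff hTc.measurableSet).2
      (continuousOn_const.integrableOn_compact hTc)
  -- Covers all uses at once: the rescaled derivative of the cut-off with `a = 1`, and `θ'` with `a
  -- = δ` and with the limit value `a = 0`.
  have hint : ∀ (η : ℝ → ℝ) (a : ℝ), Integrable η → Integrable
      fun p : ℝ × EuclideanSpace ℝ (Fin n) => η p.1 • Q (a * p.1, p.2) := by
    intro η a hη
    refine (hη.norm.mul_prod hTint).mono'
      (hη.aestronglyMeasurable.comp_fst.smul (hQm.comp_measurable (by fun_prop)).aestronglyMeasurable)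
      (Eventually.of_forall fun p => ?_)
    rw [norm_smul]
    exact mul_le_mul_of_nonneg_left (hQb _) (norm_nonneg _)
  -- the two terms of the cut-off identity
  have hkey : ∀ δ : ℝ, 0 < δ → (∫ p, θ (δ⁻¹ * p.1) • b (c.flat p)) +
      ∫ p : ℝ × EuclideanSpace ℝ (Fin n), θ' p.1 • Q (δ * p.1, p.2) = 0 := by
    intro δ hδ
    have hscale : Integrable fun t => θ' (δ⁻¹ * t) * δ⁻¹ :=
      (hθ'int.comp_mul_left' (inv_ne_zero hδ.ne')).mul_const _
    have h2 := hint _ 1 hscale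
    simp only [one_mul, Prod.mk.eta] at h2
    have h1 : Integrable fun p => θ (δ⁻¹ * p.1) • b (c.flat p) := by
      refine hBint.norm.mono' (((hθL.continuous.comp
        (continuous_const.mul continuous_fst)).smul
          (hbc.comp c.continuous_flat)).aestronglyMeasurable) (Eventually.of_forall fun p => ?_)
      rw [norm_smul]
      exact mul_le_of_le_one_left (norm_nonneg _) (hθb _)
    have h3 : ∫ p : ℝ × EuclideanSpace ℝ (Fin n), (θ' (δ⁻¹ * p.1) * δ⁻¹) • Q p =
        ∫ p : ℝ × EuclideanSpace ℝ (Fin n), θ' p.1 • Q (δ * p.1, p.2) := by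
      rw [Measure.volume_eq_prod, integral_prod_symm _ h2, integral_prod_symm _ (hint _ δ hθ'int)]
      congr 1
      ext u
      -- Substituting `t ↦ δ t` removes `δ` from the kernel `θ' (t / δ) / δ` and moves it into the
      -- argument of `Q`.
      have := Measure.integral_comp_mul_left (fun t => (θ' (δ⁻¹ * t) * δ⁻¹) • Q (t, u)) δ
      rw [abs_of_pos (inv_pos.2 hδ), eq_inv_smul_iff₀ hδ.ne', ← integral_smul] at this
      rw [← this]
      congr 1
      ext t
      rw [inv_mul_cancel_left₀ hδ.ne', smul_smul]
      congr 1
      field_simp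
    rw [← h3, ← integral_add h1 h2]
    exact c.integral_cutoff_eq_zero hΩ hh hc hψ hψc hψU hθ hθb hθ0 hθL hδ
  have hlim1 : Tendsto (fun δ : ℝ => ∫ p, θ (δ⁻¹ * p.1) • b (c.flat p)) (𝓝[>] 0)
      (𝓝 (∫ y in Ω, b y)) := by
    have heq : ∫ y in Ω, b y = ∫ p : ℝ × EuclideanSpace ℝ (Fin n),
        (if 0 < p.1 then b (c.flat p) else 0) := by
      rw [← integral_indicator hΩ.measurableSet, ← c.integral_comp_flat
        (hbc.stronglyMeasurable.indicator hΩ.measurableSet).aestronglyMeasurable]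
      congr 1
      ext p
      by_cases hp : c.flat p ∈ tsupport ψ
      · have := c.mem_iff_depth (hψU hp)
        rw [c.depth_flat] at this
        split_ifs with h
        · exact Set.indicator_of_mem (this.2 h) _
        · exact Set.indicator_of_notMem (fun h' => h (this.1 h')) _
      · simp [hb0 _ hp]
    rw [heq]
    refine tendsto_integral_filter_of_dominated_convergence (fun p => ‖b (c.flat p)‖)
      (Eventually.of_forall fun δ => ?_) (Eventually.of_forall fun δ =>
        Eventually.of_forall fun p => ?_) hBint.norm (Eventually.of_forall fun p => ?_)
    · exact ((hθL.continuous.comp (continuous_const.mul continuous_fst)).smul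
          (hbc.comp c.continuous_flat)).aestronglyMeasurable
    · rw [norm_smul]
      exact mul_le_of_le_one_left (norm_nonneg _) (hθb _)
    · refine tendsto_const_nhds.congr' ?_
      split_ifs with hp
      -- For `δ < t / 2` the argument `t / δ` exceeds `2`, where `θ = 1`.
      · filter_upwards [Ioo_mem_nhdsGT (half_pos hp)] with δ hδ
        rw [hθ1, one_smul]
        rw [le_inv_mul_iff₀ hδ.1]
        linarith [hδ.2]
      · filter_upwards [self_mem_nhdsWithin] with δ hδ
        rw [hθ0, zero_smul]
        exact (mul_nonpos_of_nonneg_of_nonpos (inv_nonneg.2 (le_of_lt hδ)) (not_lt.1 hp)).trans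
          zero_le_one
  have hlim2 : Tendsto (fun δ : ℝ => ∫ p : ℝ × EuclideanSpace ℝ (Fin n),
      θ' p.1 • Q (δ * p.1, p.2)) (𝓝[>] 0) (𝓝 (∫ u, Q (0, u))) := by
    have heq : ∫ u, Q (0, u) = ∫ p : ℝ × EuclideanSpace ℝ (Fin n), θ' p.1 • Q (0 * p.1, p.2) := by
      rw [Measure.volume_eq_prod, integral_prod_symm _ (hint _ 0 hθ'int)]
      congr 1
      ext u
      simp only [zero_mul]
      rw [integral_smul_const, hθi, one_smul]
    rw [heq]
    refine tendsto_integral_filter_of_dominated_convergence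
      (fun p => ‖θ' p.1‖ * T.indicator (fun _ => C) p.2)
      (Eventually.of_forall fun δ => (hint _ δ hθ'int).aestronglyMeasurable)
      (Eventually.of_forall fun δ => Eventually.of_forall fun p => ?_)
      (hθ'int.norm.mul_prod hTint) (Eventually.of_forall fun p => ?_)
    · rw [norm_smul]
      exact mul_le_mul_of_nonneg_left (hQb _) (norm_nonneg _)
    · refine Tendsto.mono_left ?_ nhdsWithin_le_nhds
      -- The conormal is merely measurable in `u` but does not depend on the depth, so `Q` is
      -- continuous along each vertical line.
      refine Continuous.tendsto (f := fun δ : ℝ => θ' p.1 • Q (δ * p.1, p.2)) ?_ 0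
      have h1 : Continuous fun δ : ℝ => c.flat (δ * p.1, p.2) :=
        c.continuous_flat.comp (by fun_prop)
      refine continuous_const.smul (continuous_finsetSum _ fun j _ => ?_)
      exact Continuous.const_smul ((hψ.continuous.comp h1).smul ((hc j).comp h1)) (c.conormal j p.2)
  have hsum := tendsto_nhds_unique_of_eventuallyEq (hlim1.add hlim2)
    (tendsto_const_nhds (x := (0 : F))) (by
      filter_upwards [self_mem_nhdsWithin] with δ hδ using hkey δ hδ)
  rw [eq_neg_of_add_eq_zero_left hsum]
  simp [hQ]

/-! ### Surface form, orientation and conormal -/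

/-- The determinant of a vector together with the tangent vectors of a graph. -/
theorem det_cons_graph (w : Fin (n + 1) → ℝ) (p : Fin n → ℝ) :
    Matrix.det (Matrix.of fun i k : Fin (n + 1) =>
      (Fin.cons w (fun k => Fin.cons (p k) (Pi.single k 1)) : Fin (n + 1) → Fin (n + 1) → ℝ) k i) =
      w 0 - ∑ k, p k * w k.succ := by
  set M := Matrix.of fun i k : Fin (n + 1) =>
      (Fin.cons w (fun k => Fin.cons (p k) (Pi.single k 1)) : Fin (n + 1) → Fin (n + 1) → ℝ) k i
  let e : Fin 1 ⊕ Fin n ≃ Fin (n + 1) := (finSumFinEquiv).trans (finCongr (Nat.add_comm 1 n))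
  have hl (i : Fin 1) : e (Sum.inl i) = 0 := by ext; simp [e]
  have hr (i : Fin n) : e (Sum.inr i) = i.succ := by ext; simp [e]
  rw [← Matrix.det_submatrix_equiv_self e]
  have : M.submatrix e e = Matrix.fromBlocks (Matrix.of fun _ _ => w 0) (Matrix.of fun _ k => p k)
      (Matrix.of fun i _ => w i.succ) 1 := by
    ext i j
    rcases i with i | i <;> rcases j with j | j
    · simp [M, hl]
    · simp [M, hl, hr]
    · simp [M, hl, hr]
    · simp [M, hr, Matrix.one_apply, Pi.single_apply]
  -- The lower right block is the identity, so the determinant is that of the `1 × 1` Schur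
  -- complement.
  rw [this, Matrix.det_fromBlocks_one₂₂]
  simp [Matrix.mul_apply]

theorem det_cons_map (A : E n ≃ₗᵢ[ℝ] E n) (v : Fin (n + 1) → E n) :
    Matrix.det (Matrix.of fun i k => A (v k) i) =
      LinearMap.det (A.toLinearEquiv : E n →ₗ[ℝ] E n) * Matrix.det (Matrix.of fun i k => v k i) := by
  let b := (EuclideanSpace.basisFun (Fin (n + 1)) ℝ).toBasis
  have h1 (v : Fin (n + 1) → E n) : Matrix.det (Matrix.of fun i k => v k i) = b.det v := by
    rw [Module.Basis.det_apply]
    congr 1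
  rw [h1, h1]
  exact Module.Basis.det_comp b (A.toLinearEquiv : E n →ₗ[ℝ] E n) v

/-- An isometry carries an orthonormal basis to an orthonormal basis, so its determinant is `1` or
`-1`. -/
theorem det_mul_self_eq_one (A : E n ≃ₗᵢ[ℝ] E n) :
    LinearMap.det (A.toLinearEquiv : E n →ₗ[ℝ] E n) *
      LinearMap.det (A.toLinearEquiv : E n →ₗ[ℝ] E n) = 1 := by
  let b := EuclideanSpace.basisFun (Fin (n + 1)) ℝ
  have h := Module.Basis.det_comp b.toBasis (A.toLinearEquiv : E n →ₗ[ℝ] E n) b.toBasis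
  rw [Module.Basis.det_self, mul_one] at h
  have h2 : (A.toLinearEquiv : E n →ₗ[ℝ] E n) ∘ b.toBasis = b.map A := by
    ext1 i
    simp
  rw [← h, h2]
  rcases b.det_to_matrix_orthonormalBasis_real (b.map A) with h | h <;> rw [h] <;> norm_num

namespace BoundaryChart

variable {Ω : Set (E n)} (c : BoundaryChart Ω)

theorem tangent_eq {u : EuclideanSpace ℝ (Fin n)} (hu : DifferentiableAt ℝ c.φ u) (k : Fin n) :
    c.tangent u k = c.A (WithLp.toLp 2
      (Fin.cons (fderiv ℝ c.φ u (EuclideanSpace.single k 1)) (Pi.single k 1))) := by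
  have hg : HasFDerivAt (fun u => consPt (c.φ u) u)
      ((consL n).comp ((fderiv ℝ c.φ u).prod (ContinuousLinearMap.id ℝ _))) u :=
    (consL n).hasFDerivAt.comp u (hu.hasFDerivAt.prodMk (hasFDerivAt_id u))
  have := ((c.A.toContinuousLinearEquiv : E n →L[ℝ] E n).hasFDerivAt.comp u hg).fderiv
  change fderiv ℝ c.param u = _ at this
  rw [tangent, this]
  simp
  congr 1

/-- The orientation times the surface form is the outward conormal. -/
theorem orientation_smul_dsigma {u : EuclideanSpace ℝ (Fin n)} (hu : DifferentiableAt ℝ c.φ u)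
    (s : ℤˣ) : c.orientation • dsigma s (c.tangent u) = -∑ j, c.conormal j u • unit s j := by
  have key (j : Fin (n + 1)) : c.orientation * ((-1 : ℝ) ^ (j : ℕ) *
      Matrix.det (Matrix.of fun i k : Fin n => c.tangent u k (j.succAbove i))) =
      -c.conormal j u := by
    -- Expansion along the first column: the `j`-th coefficient of `dσ` is the determinant of the
    -- `j`-th basis vector followed by the tangent vectors. Pulling this back by `A` costs a factor
    -- `det A`, which the orientation cancels.
    have h1 : Matrix.det (Matrix.of fun i k : Fin (n + 1) =>
        (Fin.cons (EuclideanSpace.single j 1) (c.tangent u) : Fin (n + 1) → E n) k i) =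
        (-1 : ℝ) ^ (j : ℕ) *
          Matrix.det (Matrix.of fun i k : Fin n => c.tangent u k (j.succAbove i)) := by
      rw [Matrix.det_succ_column_zero, Finset.sum_eq_single j]
      · simp [Matrix.submatrix]
      · intro i _ hi
        simp [hi]
      · simp
    set w : E n := c.A.symm (EuclideanSpace.single j 1) with hw
    set p : Fin n → ℝ := fun k => fderiv ℝ c.φ u (EuclideanSpace.single k 1) with hp
    set τ : Fin (n + 1) → E n := Fin.cons w fun k => WithLp.toLp 2 (Fin.cons (p k) (Pi.single k 1))
    have h2 : (Fin.cons (EuclideanSpace.single j 1) (c.tangent u) : Fin (n + 1) → E n) =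
        fun k => c.A (τ k) := by
      ext1 k
      refine Fin.cases ?_ (fun k => ?_) k
      · simp [τ, hw]
      · simp [τ, hp, c.tangent_eq hu]
    have h3 : Matrix.det (Matrix.of fun i k : Fin (n + 1) => τ k i) =
        w 0 - ∑ k, p k * w k.succ := by
      rw [← det_cons_graph (fun i => w i) p]
      congr 1
      ext i k
      refine Fin.cases ?_ (fun k => ?_) k <;> simp [τ]
    have h4 : fderiv ℝ c.φ u (tailPt w) = ∑ k, p k * w k.succ := by
      have : tailPt w = ∑ k, w k.succ • EuclideanSpace.single k (1 : ℝ) := by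
        ext i
        simp [tailPt, Pi.single_apply]
      rw [this, map_sum]
      simp [hp, mul_comm]
    rw [← h1, h2, det_cons_map, h3, ← mul_assoc, orientation, det_mul_self_eq_one, one_mul,
      conormal, ← hw, h4]
    ring
  rw [dsigma, Finset.smul_sum, ← Finset.sum_neg_distrib]
  refine Finset.sum_congr rfl fun j _ => ?_
  rw [smul_smul, key, neg_smul]

end BoundaryChart

/-! ### From charts to the whole boundary -/

theorem WeaklyDivFree.congr {Ω : Set (E n)} {h h' : Fin (n + 1) → E n → F}
    (hh : WeaklyDivFree Ω h) (heq : ∀ j, Set.EqOn (h j) (h' j) Ω) : WeaklyDivFree Ω h' := by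
  intro φ hφ hφc hφΩ
  rw [← hh φ hφ hφc hφΩ]
  congr 1
  ext y
  refine Finset.sum_congr rfl fun j _ => ?_
  by_cases hy : y ∈ tsupport φ
  · rw [heq j (hφΩ hy)]
  · rw [partialDeriv_eq_zero_of_notMem hy, zero_smul, zero_smul]

namespace BoundaryChart

variable {Ω : Set (E n)} (c : BoundaryChart Ω)

theorem continuous_param : Continuous c.param := by
  have := c.continuous_flat.comp (continuous_const.prodMk continuous_id :
    Continuous fun u : EuclideanSpace ℝ (Fin n) => ((0 : ℝ), u))
  simpa [Function.comp_def] using this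

/-- Points slightly below the graph lie in `Ω` and tend to the given point. This matters because the
integrand is controlled only on `closure Ω`. -/
theorem param_mem_closure {u : EuclideanSpace ℝ (Fin n)} (hu : c.param u ∈ c.U) :
    c.param u ∈ closure Ω := by
  have hcont : Tendsto (fun t : ℝ => c.flat (t, u)) (𝓝[>] 0) (𝓝 (c.param u)) := by
    rw [← c.flat_zero]
    exact ((c.continuous_flat.comp (continuous_id.prodMk continuous_const)).tendsto
      (0 : ℝ)).mono_left nhdsWithin_le_nhds
  refine mem_closure_of_tendsto hcont ?_
  filter_upwards [hcont (c.isOpen_U.mem_nhds hu), self_mem_nhdsWithin] with t ht h0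
  exact (c.mem_iff_depth ht).2 (by simpa using h0)

theorem integrable_conormal_smul {h : Fin (n + 1) → E n → F} (hc : ∀ j, Continuous (h j))
    {ψ : E n → ℝ} (hψ : Continuous ψ) (hψc : HasCompactSupport ψ) :
    Integrable fun u => ∑ j, c.conormal j u • (ψ (c.param u) • h j (c.param u)) := by
  refine integrable_finsetSum _ fun j _ => ?_
  obtain ⟨C, hC⟩ := c.conormal_bounded j
  have hTc : IsCompact ((fun y => tailPt (c.A.symm y)) '' tsupport ψ) :=
    hψc.isCompact.image ((tailL n).continuous.comp c.A.symm.continuous)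
  have hcont : Continuous fun u => ψ (c.param u) • h j (c.param u) :=
    (hψ.comp c.continuous_param).smul ((hc j).comp c.continuous_param)
  refine (hcont.integrable_of_hasCompactSupport
    (HasCompactSupport.intro hTc fun u hu => ?_)).bdd_smul C
      (c.measurable_conormal j).aestronglyMeasurable (Eventually.of_forall hC)
  have : ψ (c.param u) = 0 := by
    by_contra hne
    exact hu ⟨c.param u, subset_tsupport _ hne, by simp [BoundaryChart.param]⟩
  rw [this, zero_smul]

end BoundaryChart

theorem IsLipschitzDomain.isCompact_frontier {Ω : Set (E n)} (hΩ : IsLipschitzDomain Ω) :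
    IsCompact (frontier Ω) :=
  hΩ.isBounded.isCompact_closure.of_isClosed_subset isClosed_frontier frontier_subset_closure

theorem IsLipschitzDomain.nonempty_boundaryAtlas {Ω : Set (E n)} (hΩ : IsLipschitzDomain Ω) :
    Nonempty (BoundaryAtlas Ω) := by
  choose c hcU using hΩ.exists_chart
  -- The unit ball forces the functions of the partition of unity to have compact support, even if
  -- the chart domain is unbounded.
  let V : frontier Ω → Set (E n) := fun y => (c y y.2).U ∩ Metric.ball y 1
  have hVo (y) : IsOpen (V y) := (c y y.2).isOpen_U.inter Metric.isOpen_ball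
  have hcov : frontier Ω ⊆ ⋃ y, V y := fun y hy =>
    Set.mem_iUnion.2 ⟨⟨y, hy⟩, hcU y hy, Metric.mem_ball_self one_pos⟩
  obtain ⟨t, ht⟩ := hΩ.isCompact_frontier.elim_finite_subcover V hVo hcov
  let e := t.equivFin
  let V' : Fin t.card → Set (E n) := fun k => V (e.symm k)
  have ht' : frontier Ω ⊆ ⋃ k, V' k := by
    intro y hy
    obtain ⟨i, hi, hyi⟩ := Set.mem_iUnion₂.1 (ht hy)
    exact Set.mem_iUnion.2 ⟨e ⟨i, hi⟩, by simpa [V'] using hyi⟩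
  -- The partition is built over a compact neighbourhood of the frontier, so that it sums to one
  -- near the frontier and not merely on it.
  obtain ⟨L, hLc, hL1, hL2⟩ := exists_compact_between hΩ.isCompact_frontier
    (isOpen_iUnion fun k => hVo (e.symm k)) ht'
  obtain ⟨f, hf⟩ := SmoothPartitionOfUnity.exists_isSubordinate (modelWithCornersSelf ℝ (E n))
    hLc.isClosed V' (fun k => hVo (e.symm k)) hL2
  refine ⟨⟨t.card, fun k => c (e.symm k).1 (e.symm k).1.2, fun k => f k, fun k =>
    (f k).contMDiff.contDiff, fun k => ?_, fun k => (hf k).trans Set.inter_subset_left, ?_⟩⟩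
  · refine HasCompactSupport.of_support_subset_isCompact
      (isCompact_closedBall ((e.symm k).1 : E n) 1) ?_
    exact (subset_tsupport _).trans ((hf k).trans
      (Set.inter_subset_right.trans Metric.ball_subset_closedBall))
  · refine mem_of_superset (isOpen_interior.mem_nhdsSet.2 hL1) fun y hy => ?_
    have := f.sum_eq_one (interior_subset hy)
    rwa [finsum_eq_sum_of_fintype] at this

/-- The function `1 - ∑ ψₖ` vanishes near the frontier, so its extension by zero from `Ω` is smooth
with compact support in `Ω`. Testing the field against it gives the claim, since the constant `1`
has zero derivative. -/
theorem BoundaryAtlas.sum_setIntegral_eq_zero {Ω : Set (E n)} (a : BoundaryAtlas Ω)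
    (hΩ : IsOpen Ω) (hb : Bornology.IsBounded Ω) {h : Fin (n + 1) → E n → F}
    (hh : WeaklyDivFree Ω h) (hc : ∀ j, Continuous (h j)) :
    ∑ k, ∫ y in Ω, ∑ j, partialDeriv j (a.ψ k) y • h j y = 0 := by
  set χ : E n → ℝ := Ω.indicator fun y => 1 - ∑ k, a.ψ k y with hχ
  have hloc : ∀ y ∈ Ω, χ =ᶠ[𝓝 y] fun y => 1 - ∑ k, a.ψ k y := fun y hy => by
    filter_upwards [hΩ.mem_nhds hy] with z hz using Set.indicator_of_mem hz _
  have hout : ∀ y ∉ Ω, χ =ᶠ[𝓝 y] 0 := by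
    intro y hy
    by_cases hyc : y ∈ closure Ω
    · have hyf : y ∈ frontier Ω := by rw [hΩ.frontier_eq]; exact ⟨hyc, hy⟩
      filter_upwards [(eventually_nhdsSet_iff_forall.1 a.sum_ψ) y hyf] with z hz
      simp [hχ, hz]
    · filter_upwards [isClosed_closure.isOpen_compl.mem_nhds hyc] with z hz
      exact Set.indicator_of_notMem (fun h => hz (subset_closure h)) _
  have hsm0 : ContDiff ℝ ∞ fun y => 1 - ∑ k, a.ψ k y :=
    contDiff_const.sub (ContDiff.sum fun k _ => a.smooth_ψ k)
  have hsm : ContDiff ℝ ∞ χ := contDiff_iff_contDiffAt.2 fun y => by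
    by_cases hy : y ∈ Ω
    · exact hsm0.contDiffAt.congr_of_eventuallyEq (hloc y hy)
    · exact contDiffAt_const.congr_of_eventuallyEq (hout y hy)
  have hsupp : tsupport χ ⊆ Ω := fun y hy => by
    by_contra hn
    exact notMem_tsupport_iff_eventuallyEq.2 (hout y hn) hy
  have hcs : HasCompactSupport χ :=
    hb.isCompact_closure.of_isClosed_subset (isClosed_tsupport _) (hsupp.trans subset_closure)
  have h0 := hh χ hsm hcs hsupp
  rw [← setIntegral_eq_integral_of_forall_compl_eq_zero (s := Ω) fun y hy =>
    Finset.sum_eq_zero fun j _ => by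
      rw [partialDeriv_eq_zero_of_notMem fun h => hy (hsupp h), zero_smul]] at h0
  rw [← integral_finsetSum, ← neg_eq_zero, ← integral_neg, ← h0]
  · refine setIntegral_congr_fun hΩ.measurableSet fun y hy => ?_
    have hd : ∀ j, partialDeriv j χ y = -∑ k, partialDeriv j (a.ψ k) y := fun j => by
      have hder : HasFDerivAt (fun y => 1 - ∑ k, a.ψ k y) (-∑ k, fderiv ℝ (a.ψ k) y) y :=
        (HasFDerivAt.fun_sum fun k _ =>
          ((a.smooth_ψ k).differentiable (by simp) y).hasFDerivAt).const_sub 1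
      rw [partialDeriv, (hloc y hy).fderiv_eq, hder.fderiv]
      simp [partialDeriv]
    simp only [hd, neg_smul, Finset.sum_neg_distrib, Finset.sum_smul]
    rw [Finset.sum_comm]
  · intro k _
    have hcont : Continuous fun y => ∑ j, partialDeriv j (a.ψ k) y • h j y :=
      continuous_finsetSum _ fun j _ => (continuous_partialDeriv (a.smooth_ψ k) j).smul (hc j)
    refine (hcont.integrable_of_hasCompactSupport
      (HasCompactSupport.intro (a.compact_ψ k).isCompact fun y hy => ?_)).integrableOn
    exact Finset.sum_eq_zero fun j _ => by rw [partialDeriv_eq_zero_of_notMem hy, zero_smul]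

/-- Cauchy's theorem for continuous functions on `closure Ω` that satisfy `D g = 0` in `Ω` in the
sense of distributions. -/
theorem IsLipschitzDomain.hasBoundaryIntegral_zero {Ω : Set (E n)} (hΩ : IsLipschitzDomain Ω)
    {s : ℤˣ} {g : E n → Cl n} (hg : ContinuousOn g (closure Ω))
    (hgD : WeaklyDivFree Ω fun j y => unit s j * g y) : HasBoundaryIntegral s Ω g 0 := by
  refine ⟨hΩ.nonempty_boundaryAtlas, fun a => ?_⟩
  have : TietzeExtension (Cl n) := TietzeExtension.of_tvs ℝ
  -- Tietze extension: the chart computations use globally continuous fields, whereas `g` is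
  -- continuous only on `closure Ω`.
  obtain ⟨G, hG⟩ := ContinuousMap.exists_restrict_eq isClosed_closure
    (⟨_, hg.domRestrict⟩ : C(closure Ω, Cl n))
  have hGg : Set.EqOn G g (closure Ω) := fun y hy => DFunLike.congr_fun hG ⟨y, hy⟩
  have hc (j) : Continuous fun y => unit s j * G y := continuous_const.mul G.continuous
  have hh : WeaklyDivFree Ω fun j y => unit s j * G y :=
    hgD.congr fun j y hy => by simp only [hGg (subset_closure hy)]
  have hae (k) : a.integrand s g k =ᵐ[volume] fun u =>
      -∑ j, (a.chart k).conormal j u •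
        (a.ψ k ((a.chart k).param u) • (unit s j * G ((a.chart k).param u))) := by
    obtain ⟨K, hK⟩ := (a.chart k).lipschitz_φ
    filter_upwards [hK.ae_differentiableAt (μ := volume)] with u hu
    have hψg : a.ψ k ((a.chart k).param u) • g ((a.chart k).param u) =
        a.ψ k ((a.chart k).param u) • G ((a.chart k).param u) := by
      by_cases h0 : a.ψ k ((a.chart k).param u) = 0
      · rw [h0, zero_smul, zero_smul]
      · rw [hGg ((a.chart k).param_mem_closure (a.tsupport_ψ k (subset_tsupport _ h0)))]
    calc a.integrand s g k u
        = ((a.chart k).orientation • dsigma s ((a.chart k).tangent u)) *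
            (a.ψ k ((a.chart k).param u) • g ((a.chart k).param u)) := by
          rw [BoundaryAtlas.integrand, smul_mul_smul_comm, mul_comm]
      _ = _ := by
          rw [hψg, (a.chart k).orientation_smul_dsigma hu, neg_mul, Finset.sum_mul]
          congr 1
          refine Finset.sum_congr rfl fun j _ => ?_
          rw [smul_mul_assoc, mul_smul_comm]
  refine ⟨fun k => (((a.chart k).integrable_conormal_smul hc (a.smooth_ψ k).continuous
    (a.compact_ψ k)).neg).congr (hae k).symm, ?_⟩
  rw [← a.sum_setIntegral_eq_zero hΩ.isOpen hΩ.isBounded hh hc]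
  refine Finset.sum_congr rfl fun k _ => ?_
  rw [integral_congr_ae (hae k), integral_neg,
    (a.chart k).setIntegral_partialDeriv_smul hΩ.isOpen hh hc (a.smooth_ψ k) (a.compact_ψ k)
      (a.tsupport_ψ k)]

/-! ### Classical solutions are weak solutions -/

/-- The divergence of a differentiable, compactly supported vector field has integral zero as soon
as it is integrable. -/
theorem integral_divergence_eq_zero {G : Fin (n + 1) → E n → F}
    (hG : ∀ j, Differentiable ℝ (G j)) (hGc : ∀ j, HasCompactSupport (G j))
    (hint : Integrable fun y => ∑ j, partialDeriv j (G j) y) :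
    ∫ y, ∑ j, partialDeriv j (G j) y = 0 := by
  have hbdd : Bornology.IsBounded (⋃ j, tsupport (G j)) :=
    (isCompact_iUnion fun j => (hGc j).isCompact).isBounded
  obtain ⟨R, hR0, hR⟩ := hbdd.subset_ball_lt 0 0
  have hmem : ∀ (y : E n) (j i), y ∈ tsupport (G j) → |y i| < R := fun y j i hy => by
    have := hR (Set.mem_iUnion.2 ⟨j, hy⟩)
    rw [mem_ball_zero_iff] at this
    exact (PiLp.norm_apply_le y i).trans_lt this
  have hdiv : ∀ y : E n, (∃ i, R ≤ |y i|) → ∑ j, partialDeriv j (G j) y = 0 := by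
    rintro y ⟨i, hi⟩
    exact Finset.sum_eq_zero fun j _ =>
      partialDeriv_eq_zero_of_notMem (fun h => hi.not_gt (hmem y j i h)) j
  let e : (Fin (n + 1) → ℝ) →L[ℝ] E n :=
    ((PiLp.continuousLinearEquiv 2 ℝ fun _ : Fin (n + 1) => ℝ).symm :
      (Fin (n + 1) → ℝ) →L[ℝ] E n)
  have he : ∀ x i, e x i = x i := fun x i => rfl
  have hmp : MeasurePreserving e := PiLp.volume_preserving_toLp (Fin (n + 1))
  have hpd : ∀ x, ∑ j, ((fderiv ℝ (G j) (e x)).comp e) (Pi.single j 1) =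
      ∑ j, partialDeriv j (G j) (e x) := fun x => rfl
  have hint' : Integrable fun x => ∑ j, partialDeriv j (G j) (e x) :=
    (hmp.integrable_comp hint.aestronglyMeasurable).2 hint
  -- This divergence theorem on a box needs differentiability and integrability of the divergence
  -- only, not continuity of the partial derivatives; `f` is merely assumed differentiable. On the
  -- faces of the box the field vanishes.
  have key := integral_divergence_of_hasFDerivAt_off_countable' (fun _ => -R) (fun _ => R)
    (fun _ => by linarith) (fun j x => G j (e x)) (fun j x => (fderiv ℝ (G j) (e x)).comp e) ∅
    Set.countable_empty (fun j => ((hG j).continuous.comp e.continuous).continuousOn)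
    (fun x _ j => ((hG j) (e x)).hasFDerivAt.comp x e.hasFDerivAt)
    (by simp only [hpd]; exact hint'.integrableOn)
  have hface : ∀ (j : Fin (n + 1)) (r : ℝ) (x : Fin n → ℝ), |r| = R →
      G j (e (j.insertNth r x)) = 0 := fun j r x hr => by
    refine image_eq_zero_of_notMem_tsupport fun h => ?_
    have := hmem _ j j h
    rw [he, Fin.insertNth_apply_same, hr] at this
    exact lt_irrefl _ this
  simp only [hpd, hface _ R _ (abs_of_pos hR0), hface _ (-R) _ ((abs_neg R).trans (abs_of_pos hR0)),
    integral_zero, sub_zero, Finset.sum_const_zero] at key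
  rw [setIntegral_eq_integral_of_forall_compl_eq_zero] at key
  · rw [← key]
    have hm := hint.aestronglyMeasurable
    rw [← hmp.map_eq] at hm ⊢
    exact integral_map hmp.measurable.aemeasurable hm
  · intro x hx
    refine hdiv _ ?_
    by_contra! hlt
    refine hx ⟨fun i => ?_, fun i => ?_⟩
    · exact (abs_lt.1 (hlt i)).1.le
    · exact (abs_lt.1 (hlt i)).2.le

theorem partialDeriv_smul {φ : E n → ℝ} {g : E n → F} {y : E n} (hφ : DifferentiableAt ℝ φ y)
    (hg : DifferentiableAt ℝ g y) (j : Fin (n + 1)) :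
    partialDeriv j (fun y => φ y • g y) y = partialDeriv j φ y • g y + φ y • partialDeriv j g y := by
  rw [partialDeriv, fderiv_fun_smul hφ hg]
  simp [partialDeriv, add_comm]

theorem continuous_smul_of_tsupport_subset {W : Set (E n)} (hW : IsOpen W) {φ : E n → ℝ}
    {g : E n → F} (hφ : Continuous φ) (hφW : tsupport φ ⊆ W) (hg : ContinuousOn g W) :
    Continuous fun y => φ y • g y :=
  continuous_of_tsupport fun _ hx => (hφ.continuousOn.smul hg).continuousAt
    (hW.mem_nhds (hφW (tsupport_smul_subset_left φ g hx)))

theorem tsupport_partialDeriv_subset (φ : E n → F) (j : Fin (n + 1)) :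
    tsupport (partialDeriv j φ) ⊆ tsupport φ :=
  closure_minimal (fun y hy => by
    by_contra h
    exact hy (partialDeriv_eq_zero_of_notMem h j)) (isClosed_tsupport _)

theorem integrable_smul_of_tsupport_subset {W : Set (E n)} (hW : IsOpen W) {φ : E n → ℝ}
    {g : E n → F} (hφ : Continuous φ) (hφc : HasCompactSupport φ) (hφW : tsupport φ ⊆ W)
    (hg : ContinuousOn g W) : Integrable fun y => φ y • g y :=
  (continuous_smul_of_tsupport_subset hW hφ hφW hg).integrable_of_hasCompactSupport hφc.smul_right

theorem integrable_sum_partialDeriv_smul {W : Set (E n)} (hW : IsOpen W) {φ : E n → ℝ}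
    {g : Fin (n + 1) → E n → F} (hφ : ContDiff ℝ ∞ φ) (hφc : HasCompactSupport φ)
    (hφW : tsupport φ ⊆ W) (hg : ∀ j, ContinuousOn (g j) W) :
    Integrable fun y => ∑ j, partialDeriv j φ y • g j y :=
  integrable_finsetSum _ fun j _ =>
    integrable_smul_of_tsupport_subset hW (continuous_partialDeriv hφ j)
      (hφc.of_isClosed_subset (isClosed_tsupport _) (tsupport_partialDeriv_subset φ j))
      ((tsupport_partialDeriv_subset φ j).trans hφW) (hg j)

/-- Classical solutions of `D f = h` with continuous right hand side are weak solutions. -/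
theorem WeakCauchyRiemann.of_differentiableOn {s : ℤˣ} {W : Set (E n)} (hW : IsOpen W)
    {f h : E n → Cl n} (hf : DifferentiableOn ℝ f W)
    (hfh : ∀ y ∈ W, cauchyRiemann s f y = h y) (hh : ContinuousOn h W) :
    WeakCauchyRiemann s W f h := by
  intro φ hφ hφc hφW
  set G : Fin (n + 1) → E n → Cl n := fun j y => φ y • (unit s j * f y) with hG
  have hts (j) : tsupport (G j) ⊆ tsupport φ := tsupport_smul_subset_left φ _
  have hfd : ∀ y ∈ tsupport φ, ∀ j, DifferentiableAt ℝ (fun y => unit s j * f y) y :=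
    fun y hy j => (hf.differentiableAt (hW.mem_nhds (hφW hy))).const_mul (unit s j)
  have hφd : Differentiable ℝ φ := hφ.differentiable (by simp)
  have hGd (j) : Differentiable ℝ (G j) := fun y => by
    by_cases hy : y ∈ tsupport φ
    · exact (hφd y).smul (hfd y hy j)
    · exact (differentiableAt_const (0 : Cl n)).congr_of_eventuallyEq
        (notMem_tsupport_iff_eventuallyEq.1 fun h => hy (hts j h))
  -- The single partial derivatives of `f` may fail to be integrable; only their combination `D f =
  -- h` enters, and `h` is continuous.
  have hpd (y) : ∑ j, partialDeriv j (G j) y =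
      (∑ j, partialDeriv j φ y • (unit s j * f y)) + φ y • h y := by
    by_cases hy : y ∈ tsupport φ
    · rw [← hfh y (hφW hy), cauchyRiemann, Finset.smul_sum, ← Finset.sum_add_distrib]
      refine Finset.sum_congr rfl fun j _ => ?_
      rw [hG, partialDeriv_smul (hφd y) (hfd y hy j)]
      congr 2
      have := ((hf.differentiableAt (hW.mem_nhds (hφW hy))).hasFDerivAt.const_mul (unit s j)).fderiv
      rw [partialDeriv, this]
      rfl
    · rw [image_eq_zero_of_notMem_tsupport hy, zero_smul, add_zero]
      refine Finset.sum_congr rfl fun j _ => ?_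
      rw [partialDeriv_eq_zero_of_notMem hy, zero_smul,
        partialDeriv_eq_zero_of_notMem fun h => hy (hts j h)]
  have hi1 := integrable_sum_partialDeriv_smul hW hφ hφc hφW
    (g := fun j y => unit s j * f y) fun j => continuousOn_const.mul hf.continuousOn
  have hi2 := integrable_smul_of_tsupport_subset hW hφ.continuous hφc hφW hh
  have key := integral_divergence_eq_zero hGd (fun j => hφc.smul_right) (by
    simp only [hpd]
    exact hi1.add hi2)
  simp only [hpd] at key
  rw [integral_add hi1 hi2] at key
  exact eq_neg_of_add_eq_zero_left key

/-! ### The exponential series of `M` -/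

theorem ext_of_mem {W : Set (E n)} (f : Fun n W) {y : E n} (hy : y ∈ closure W) :
    ext f y = f ⟨y, hy⟩ := dif_pos hy

theorem ext_of_notMem {W : Set (E n)} (f : Fun n W) {y : E n} (hy : y ∉ closure W) :
    ext f y = 0 := dif_neg hy

theorem continuousOn_ext {W : Set (E n)} (f : Fun n W) : ContinuousOn (ext f) (closure W) := by
  rw [continuousOn_iff_continuous_domRestrict]
  convert f.continuous using 1
  ext y
  exact ext_of_mem f y.2

theorem norm_ext_le {W : Set (E n)} (f : Fun n W) (y : E n) : ‖ext f y‖ ≤ ‖f‖ := by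
  by_cases hy : y ∈ closure W
  · rw [ext_of_mem f hy]
    exact f.norm_coe_le_norm _
  · rw [ext_of_notMem f hy, norm_zero]
    exact norm_nonneg f

theorem norm_pow_apply_le {V : Type*} [NormedAddCommGroup V] [NormedSpace ℝ V] (M : V →L[ℝ] V)
    (f : V) (k : ℕ) : ‖(M ^ k) f‖ ≤ ‖M‖ ^ k * ‖f‖ := by
  induction k with
  | zero => simp
  | succ k ih =>
    rw [pow_succ', pow_succ', mul_assoc]
    exact (M.le_opNorm _).trans (mul_le_mul_of_nonneg_left ih (norm_nonneg _))

/-- The coefficient `(-y₀)ᵏ / k!` of the exponential series. -/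
def expCoeff (k : ℕ) (y : E n) : ℝ := (-(y 0)) ^ k / (k.factorial : ℝ)

theorem contDiff_expCoeff (k : ℕ) : ContDiff ℝ ∞ (expCoeff (n := n) k) := by
  have : ContDiff ℝ ∞ fun y : E n => y 0 := (EuclideanSpace.proj 0 : E n →L[ℝ] ℝ).contDiff
  exact (this.neg.pow k).div_const _

theorem norm_expCoeff_le (k : ℕ) {y : E n} {R : ℝ} (hy : |y 0| ≤ R) :
    ‖expCoeff k y‖ ≤ R ^ k / (k.factorial : ℝ) := by
  rw [expCoeff, norm_div, norm_pow, norm_neg, Real.norm_eq_abs, RCLike.norm_natCast]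
  gcongr

theorem partialDeriv_expCoeff_zero (j : Fin (n + 1)) (y : E n) :
    partialDeriv j (expCoeff 0) y = 0 := by
  have : expCoeff (n := n) 0 = fun _ => 1 := by ext; simp [expCoeff]
  rw [this, partialDeriv]
  simp

/-- The relation `∂₀ cₖ₊₁ = -cₖ` between the coefficients is what makes the sum in
`weaklyDivFree_expNeg` telescope. -/
theorem partialDeriv_expCoeff_succ (k : ℕ) (j : Fin (n + 1)) (y : E n) :
    partialDeriv j (expCoeff (k + 1)) y = if j = 0 then -expCoeff k y else 0 := by
  have h1 : HasFDerivAt (fun y : E n => -(y 0)) (-(EuclideanSpace.proj 0 : E n →L[ℝ] ℝ)) y :=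
    (EuclideanSpace.proj 0 : E n →L[ℝ] ℝ).hasFDerivAt.neg
  have h2 := ((hasDerivAt_pow (k + 1) (-(y 0))).div_const
    ((k + 1).factorial : ℝ)).comp_hasFDerivAt y h1
  rw [partialDeriv]
  change fderiv ℝ ((fun x : ℝ => x ^ (k + 1) / ((k + 1).factorial : ℝ)) ∘
    fun y : E n => -(y 0)) y _ = _
  rw [h2.fderiv]
  by_cases hj : j = 0
  · subst hj
    have : ((k : ℝ) + 1) ≠ 0 := by positivity
    have h3 : (k.factorial : ℝ) ≠ 0 := by positivity
    simp [expCoeff, Nat.factorial_succ]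
    field_simp
  · simp [hj, Ne.symm hj]

section expNeg

variable {W : Set (E n)} (M : Fun n W →L[ℝ] Fun n W) (f : Fun n W)

theorem expNeg_eq (y : E n) : expNeg M f y = ∑' k, expCoeff k y • ext ((M ^ k) f) y := rfl

theorem norm_expNeg_term_le (k : ℕ) {y : E n} {R : ℝ} (hy : |y 0| ≤ R) :
    ‖expCoeff k y • ext ((M ^ k) f) y‖ ≤ (R * ‖M‖) ^ k / (k.factorial : ℝ) * ‖f‖ := by
  rw [norm_smul]
  have hR : 0 ≤ R := (abs_nonneg _).trans hy
  calc _ ≤ R ^ k / (k.factorial : ℝ) * (‖M‖ ^ k * ‖f‖) :=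
        mul_le_mul (norm_expCoeff_le k hy) ((norm_ext_le _ y).trans (norm_pow_apply_le M f k))
          (norm_nonneg _) (by positivity)
    _ = _ := by rw [mul_pow]; ring

theorem summable_expNeg_bound (R : ℝ) :
    Summable fun k : ℕ => (R * ‖M‖) ^ k / (k.factorial : ℝ) * ‖f‖ :=
  (Real.summable_pow_div_factorial _).mul_right _

theorem hasSum_expNeg (y : E n) :
    HasSum (fun k => expCoeff k y • ext ((M ^ k) f) y) (expNeg M f y) :=
  (Summable.of_norm_bounded (summable_expNeg_bound M f |y 0|)
    fun k => norm_expNeg_term_le M f k le_rfl).hasSum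

/-- On a bounded set `|y₀| ≤ R`, so the series converges uniformly. On an unbounded `W` the sum need
not be bounded, which is why it is treated as a function and not as an element of `Fun n W`. -/
theorem continuousOn_expNeg {S : Set (E n)} (hS : Bornology.IsBounded S) (hSW : S ⊆ closure W) :
    ContinuousOn (expNeg M f) S := by
  obtain ⟨R, hR⟩ := hS.exists_norm_le
  refine continuousOn_tsum (fun k => ?_) (summable_expNeg_bound M f R) fun k y hy =>
    norm_expNeg_term_le M f k ((PiLp.norm_apply_le y 0).trans (hR y hy))
  exact (contDiff_expCoeff k).continuous.continuousOn.smul ((continuousOn_ext _).mono hSW)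

theorem weakCauchyRiemann_pow {s : ℤˣ} {M} {f : Fun n W} (hM : CommutesWithD s W M)
    (hf : WeakCauchyRiemann s W (ext f) (ext (M f))) (k : ℕ) :
    WeakCauchyRiemann s W (ext ((M ^ k) f)) (ext ((M ^ (k + 1)) f)) := by
  induction k with
  | zero => simpa using hf
  | succ k ih =>
    have := hM _ _ ih
    rwa [← mul_apply_eq_comp, ← mul_apply_eq_comp, ← pow_succ',
      ← pow_succ'] at this

end expNeg

theorem unit_zero (s : ℤˣ) : unit (n := n) s 0 = 1 := rfl

/-- `D (e^{-y₀ M} f) = 0` in the sense of distributions. -/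
theorem weaklyDivFree_expNeg {s : ℤˣ} {W : Set (E n)} (hW : IsOpen W)
    {M : Fun n W →L[ℝ] Fun n W} {f : Fun n W} (hM : CommutesWithD s W M)
    (hf : WeakCauchyRiemann s W (ext f) (ext (M f))) :
    WeaklyDivFree W fun j y => unit s j * expNeg M f y := by
  intro χ hχ hχc hχW
  obtain ⟨R, hRpos, hR⟩ := hχc.isCompact.isBounded.exists_pos_norm_le
  have hR0 : ∀ y ∈ tsupport χ, |y 0| ≤ R := fun y hy => (PiLp.norm_apply_le y 0).trans (hR y hy)
  set p : ℕ → E n → Cl n := fun k => ext ((M ^ k) f) with hp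
  have hpc (k) : ContinuousOn (p k) W := (continuousOn_ext _).mono subset_closure
  set D : ℕ → E n → Cl n := fun k y => ∑ j, partialDeriv j χ y • (unit s j * (expCoeff k y • p k y))
    with hD
  have hterm (k) (j) : ContinuousOn (fun y => unit s j * (expCoeff k y • p k y)) W :=
    continuousOn_const.mul ((contDiff_expCoeff k).continuous.continuousOn.smul (hpc k))
  have hDint (k) : Integrable (D k) :=
    integrable_sum_partialDeriv_smul hW hχ hχc hχW (hterm k)
  set b : ℕ → Cl n := fun k => ∫ y, χ y • (expCoeff k y • p (k + 1) y) with hb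
  have hbint (k) : Integrable fun y => χ y • (expCoeff k y • p (k + 1) y) :=
    integrable_smul_of_tsupport_subset hW hχ.continuous hχc hχW
      ((contDiff_expCoeff k).continuous.continuousOn.smul (hpc (k + 1)))
  -- the equation for the `k`-th power, tested against `χ` times the `k`-th coefficient
  have hweak (k) : ∫ y, ∑ j, partialDeriv j (fun y => χ y * expCoeff k y) y • (unit s j * p k y) =
      -b k := by
    have := weakCauchyRiemann_pow hM hf k (fun y => χ y * expCoeff k y)
      (hχ.mul (contDiff_expCoeff k)) hχc.mul_right
      ((closure_mono (Function.support_mul_subset_left χ _)).trans hχW)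
    simpa only [mul_smul] using this
  have hprod (k j) (y) : partialDeriv j (fun y => χ y * expCoeff k y) y =
      partialDeriv j χ y * expCoeff k y + χ y * partialDeriv j (expCoeff k) y :=
    partialDeriv_smul (hχ.differentiable (by simp) y)
      ((contDiff_expCoeff k).differentiable (by simp) y) j
  -- By the product rule the `k`-th weak equation reads `∫ D k = b (k - 1) - b k`, with no `b (k -
  -- 1)` for `k = 0`; the sum over `k ≤ N` collapses to `-b N`.
  have hpartial (N : ℕ) : ∑ k ∈ Finset.range (N + 1), ∫ y, D k y = -b N := by
    induction N with
    | zero =>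
      rw [Finset.sum_range_one, ← hweak 0]
      congr 1
      ext y
      refine Finset.sum_congr rfl fun j _ => ?_
      rw [hprod, partialDeriv_expCoeff_zero, mul_zero, add_zero, mul_smul, mul_smul_comm]
    | succ N ih =>
      rw [Finset.sum_range_succ, ih, ← hweak (N + 1), neg_add_eq_iff_eq_add, hb, ← integral_add
        (hbint N)]
      · congr 1
        ext y
        have : χ y • expCoeff N y • p (N + 1) y = -∑ j : Fin (n + 1),
            (χ y * partialDeriv j (expCoeff (N + 1)) y) • (unit s j * p (N + 1) y) := by
          rw [Finset.sum_eq_single 0]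
          · rw [partialDeriv_expCoeff_succ, if_pos rfl, unit_zero, one_mul, mul_neg, neg_smul,
              neg_neg, mul_smul]
          · intro j _ hj
            rw [partialDeriv_expCoeff_succ, if_neg hj, mul_zero, zero_smul]
          · simp
        rw [this, ← Finset.sum_neg_distrib, ← Finset.sum_add_distrib]
        refine Finset.sum_congr rfl fun j _ => ?_
        rw [hprod, add_smul, neg_add_cancel_comm_assoc, mul_smul, mul_smul_comm]
      · have := integrable_sum_partialDeriv_smul hW (hχ.mul (contDiff_expCoeff (N + 1)))
          hχc.mul_right ((closure_mono (Function.support_mul_subset_left χ _)).trans hχW)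
          (g := fun j y => unit s j * p (N + 1) y) fun j => continuousOn_const.mul (hpc (N + 1))
        exact this
  set B : ℕ → ℝ := fun k => (R * ‖M‖) ^ k / (k.factorial : ℝ) * ‖f‖ with hB
  have hB0 (k) : 0 ≤ B k := by positivity
  have hBs : Summable B := summable_expNeg_bound M f R
  have hχint : Integrable χ := hχ.continuous.integrable_of_hasCompactSupport hχc
  -- The remainder is at most `‖M‖ * B k * ∫ ‖χ‖`, where `B k` is the general term of a convergent
  -- exponential series.
  have hb0 : Tendsto b atTop (𝓝 0) := by
    have hlim : Tendsto (fun k => ‖M‖ * B k * ∫ y, ‖χ y‖) atTop (𝓝 0) := by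
      simpa using (hBs.tendsto_atTop_zero.const_mul ‖M‖).mul_const (∫ y, ‖χ y‖)
    refine squeeze_zero_norm (fun k => ?_) hlim
    rw [← integral_const_mul]
    refine norm_integral_le_of_norm_le (hχint.norm.const_mul _) (Eventually.of_forall fun y => ?_)
    by_cases hy : y ∈ tsupport χ
    · have h1 := norm_expCoeff_le k (hR0 y hy)
      have h2 := (norm_ext_le ((M ^ (k + 1)) f) y).trans (norm_pow_apply_le M f (k + 1))
      rw [norm_smul, norm_smul, mul_comm]
      refine mul_le_mul_of_nonneg_right ?_ (norm_nonneg _)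
      calc _ ≤ R ^ k / (k.factorial : ℝ) * (‖M‖ ^ (k + 1) * ‖f‖) :=
            mul_le_mul h1 h2 (norm_nonneg _) (by positivity)
        _ = _ := by rw [hB]; simp only [mul_pow]; ring
    · simp [image_eq_zero_of_notMem_tsupport hy]
  have hsum : HasSum (fun k => ∫ y, D k y)
      (∫ y, ∑ j, partialDeriv j χ y • (unit s j * expNeg M f y)) := by
    refine hasSum_integral_of_dominated_convergence
      (fun k y => B k * ∑ j, ‖partialDeriv j χ y‖ * ‖unit (n := n) s j‖)
      (fun k => (hDint k).aestronglyMeasurable) (fun k => Eventually.of_forall fun y => ?_)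
      (Eventually.of_forall fun y => hBs.mul_right _) ?_ (Eventually.of_forall fun y => ?_)
    · rw [Finset.mul_sum]
      refine (norm_sum_le _ _).trans (Finset.sum_le_sum fun j _ => ?_)
      by_cases hy : y ∈ tsupport χ
      · rw [norm_smul]
        calc _ ≤ ‖partialDeriv j χ y‖ * (‖unit (n := n) s j‖ * B k) := by
              gcongr
              exact (norm_mul_le _ _).trans (mul_le_mul_of_nonneg_left
                (norm_expNeg_term_le M f k (hR0 y hy)) (norm_nonneg _))
          _ = _ := by ring
      · simp [partialDeriv_eq_zero_of_notMem hy]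
    · simp only [tsum_mul_right]
      refine Integrable.const_mul (integrable_finsetSum _ fun j _ => Integrable.mul_const ?_ _) _
      exact ((continuous_partialDeriv hχ j).integrable_of_hasCompactSupport
        (hχc.of_isClosed_subset (isClosed_tsupport _) (tsupport_partialDeriv_subset χ j))).norm
    · exact hasSum_sum fun j _ => ((hasSum_expNeg M f y).mul_left (unit s j)).const_smul _
  have h1 := (tendsto_add_atTop_iff_nat 1).2 hsum.tendsto_sum_nat
  simp only [hpartial] at h1
  simpa using tendsto_nhds_unique h1 hb0.neg

/-! ### Right multiplication and the main theorem -/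

/-- The coefficients of `D` multiply from the left, so by associativity right multiplication passes
through the weak equation; being continuous and linear, it also passes through the integrals. -/
theorem commutesWithD_rightMul {s : ℤˣ} {W : Set (E n)} (hW : IsOpen W) (lam : Cl n) :
    CommutesWithD s W (rightMul W lam) := by
  intro f h hfh φ hφ hφc hφW
  have hext (g : Fun n W) (y : E n) : ext (rightMul W lam g) y = ext g y * lam := by
    by_cases hy : y ∈ closure W
    · rw [ext_of_mem _ hy, ext_of_mem _ hy, rightMul_apply]
    · rw [ext_of_notMem _ hy, ext_of_notMem _ hy, zero_mul]
  have hc (g : Fun n W) : ContinuousOn (ext g) W := (continuousOn_ext g).mono subset_closure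
  have hi1 := integrable_sum_partialDeriv_smul hW hφ hφc hφW
    (g := fun j y => unit s j * ext f y) fun j => continuousOn_const.mul (hc f)
  have hi2 := integrable_smul_of_tsupport_subset hW hφ.continuous hφc hφW (hc h)
  have key := congrArg ((ContinuousLinearMap.mul ℝ (Cl n)).flip lam) (hfh φ hφ hφc hφW)
  rw [map_neg, ← ContinuousLinearMap.integral_comp_comm _ hi1,
    ← ContinuousLinearMap.integral_comp_comm _ hi2] at key
  simpa [hext, Finset.sum_mul, smul_mul_assoc, mul_assoc] using key

theorem expNeg_rightMul {W : Set (E n)} (lam : Cl n) (f : Fun n W) (y : E n) :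
    expNeg (rightMul W lam) f y = ext f y * NormedSpace.exp ((-(y 0)) • lam) := by
  have hpow (k : ℕ) : ext ((rightMul W lam ^ k) f) y = ext f y * lam ^ k := by
    by_cases hy : y ∈ closure W
    · rw [ext_of_mem _ hy, ext_of_mem _ hy]
      induction k with
      | zero => simp
      | succ k ih => rw [pow_succ', mul_apply_eq_comp, rightMul_apply, ih, pow_succ, mul_assoc]
    · rw [ext_of_notMem _ hy, ext_of_notMem _ hy, zero_mul]
  rw [expNeg_eq, congrFun (NormedSpace.exp_eq_tsum ℝ) _, ← Summable.tsum_mul_left]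
  · refine tsum_congr fun k => ?_
    rw [hpow, expCoeff, smul_pow, smul_smul, mul_smul_comm, div_eq_inv_mul]
  · exact NormedSpace.expSeries_summable' _

/-- Cauchy's theorem for `M`-solutions. -/
theorem hasBoundaryIntegral_expNeg {s : ℤˣ} {W Ω : Set (E n)} (hW : IsOpen W)
    (hΩ : IsLipschitzDomain Ω) (hΩW : Ω ⊆ W) {M : Fun n W →L[ℝ] Fun n W}
    (hM : CommutesWithD s W M) {f : Fun n W} (hf : f ∈ massSolutions s W M) :
    HasBoundaryIntegral s Ω (expNeg M f) 0 := by
  refine hΩ.hasBoundaryIntegral_zero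
    (continuousOn_expNeg M f hΩ.isBounded.closure (closure_mono hΩW)) fun φ hφ hφc hφΩ => ?_
  exact weaklyDivFree_expNeg hW hM (WeakCauchyRiemann.of_differentiableOn hW hf.1 hf.2
    ((continuousOn_ext _).mono subset_closure)) φ hφ hφc (hφΩ.trans hΩW)

end CliffordCauchy

end

theorem mainTheorem4 (n : ℕ) (s : ℤˣ) (W Ω : Set (CliffordCauchy.E n)) (hW : IsOpen W)
    (hΩ : CliffordCauchy.IsLipschitzDomain Ω) (hΩW : Ω ⊆ W) :
    (∀ M : CliffordCauchy.Fun n W →L[ℝ] CliffordCauchy.Fun n W,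
      CliffordCauchy.CommutesWithD s W M →
      ∀ f ∈ CliffordCauchy.massSolutions s W M,
        CliffordCauchy.HasBoundaryIntegral s Ω (fun y => CliffordCauchy.expNeg M f y) 0) ∧
    (∀ lam : CliffordCauchy.Cl n,
      ∀ f ∈ CliffordCauchy.massSolutions s W (CliffordCauchy.rightMul W lam),
        CliffordCauchy.HasBoundaryIntegral s Ω
          (fun y => CliffordCauchy.ext f y * NormedSpace.exp ((-(y 0)) • lam)) 0) ∧
    (∀ lam : ℝ,
      ∀ f ∈ CliffordCauchy.massSolutions s W
          (CliffordCauchy.rightMul W (algebraMap ℝ (CliffordCauchy.Cl n) lam)),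
        CliffordCauchy.HasBoundaryIntegral s Ω
          (fun y => algebraMap ℝ (CliffordCauchy.Cl n) (Real.exp (-(y 0 * lam))) *
            CliffordCauchy.ext f y) 0) := by
  have hr : ∀ lam : CliffordCauchy.Cl n,
      ∀ f ∈ CliffordCauchy.massSolutions s W (CliffordCauchy.rightMul W lam),
        CliffordCauchy.HasBoundaryIntegral s Ω
          (fun y => CliffordCauchy.ext f y * NormedSpace.exp ((-(y 0)) • lam)) 0 := by
    intro lam f hf
    simp only [← CliffordCauchy.expNeg_rightMul]
    exact CliffordCauchy.hasBoundaryIntegral_expNeg hW hΩ hΩW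
      (CliffordCauchy.commutesWithD_rightMul hW lam) hf
  refine ⟨fun M hM f hf => CliffordCauchy.hasBoundaryIntegral_expNeg hW hΩ hΩW hM hf, hr,
    fun lam f hf => ?_⟩
  -- For real `λ` the exponential is a real scalar, hence central, and may be moved to the left of
  -- `f`.
  convert hr _ f hf using 2 with y
  rw [Algebra.smul_def, ← map_mul, ← NormedSpace.algebraMap_exp_comm, ← Real.exp_eq_exp_ℝ,
    neg_mul, Algebra.commutes]
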